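/- All Hilbert spaces are finite-dimensional, all alphabets are finite, and $\log=\log_2$. A state is a positive semidefinite operator of trace one. A cq-state is a state of the form $\rho_{XE}=\sum_{x\in\mathcal X}P_X(x)\,|x\rangle\langle x|\otimes\rho_E^x$, with $P_X$ a probability distribution, $(|x\rangle)_{x\in\mathcal X}$ an orthonormal basis of the register $X$, and every $\rho_E^x$ a state. For $\rho_{AB}\ge 0$ put $$H_\infty(A|B)_\rho=-\log\min\{\operatorname{Tr}\sigma_B:\ \sigma_B\ge 0,\ \rho_{AB}\le \mathrm{id}_A\otimes\sigma_B\}\in(-\infty,+\infty],$$ with $-\log 0=+\infty$. Put $F(\rho,\tau)=\|\sqrt\rho\sqrt\tau\|_1$, where $\|M\|_1=\operatorname{Tr}\sqrt{M^\dagger M}$, and $C(\rho,\tau)=\sqrt{1-F(\rho,\tau)^2}$. For $\varepsilon\ge 0$, the smooth min-entropy is $$H_\infty^{\varepsilon}(A|B)_\rho=\sup\{H_\infty(A|B)_{\hat\rho}:\ \hat\rho_{AB}\ge 0,\ \operatorname{Tr}\hat\rho_{AB}\le 1,\ C(\rho_{AB},\hat\rho_{AB})\le\varepsilon\}.$$ **Lemma.**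 Let $\varepsilon\ge 0$ and $\alpha\in\mathbb R$, and let $\rho_{X_0E_0}$ and $\rho_{X_1E_1}$ be two independent cq-states, that is, with joint state $\rho_{X_0X_1E_0E_1}=\rho_{X_0E_0}\otimes\rho_{X_1E_1}$, such that $$H_\infty^{\varepsilon^2}(X_0X_1|E_0E_1)\ge\alpha .$$ Let $S_0,S_1$ be classical random variables over $\{0,1\}^\ell$, arbitrarily correlated with these systems: $\rho_{X_0X_1S_0S_1E_0E_1}$ is any cq-state (classical on $X_0X_1S_0S_1$, quantum on $E_0E_1$) that reduces to $\rho_{X_0E_0}\otimes\rho_{X_1E_1}$ when $S_0S_1$ is traced out. Then there is a bit $D\in\{0,1\}$ (a constant, hence in particular a random variable) such that, with $\overline D=1-D$, $$H_\infty^{\varepsilon}(X_{\overline D}\,D\,S_D\,|\,E_0E_1)\ge\alpha/2 .$$ Here the classical registers $X_{\overline D}\,D\,S_D$ together take values in $(\mathcal X_0\sqcup\mathcal X_1)\times\{0,1\}\times\{0,1\}^\ell$. -/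

import Mathlib

open scoped ComplexOrder MatrixOrder Kronecker

noncomputable section

/-! Operators on a finite-dimensional Hilbert space are written as complex matrices over an
orthonormal basis indexed by a finite type; the composite of systems with bases `A` and `B`
has basis `A × B`, with the classical register (if there is one) on the left. -/

/-- A quantum state: a positive semidefinite operator of trace one. -/
def IsState {A : Type*} [Fintype A] (ρ : Matrix A A ℂ) : Prop :=
  ρ.PosSemidef ∧ ρ.trace = 1

/-- A cq-state `ρ_XE = ∑ₓ P_X(x) |x⟩⟨x| ⊗ ρ_E^x`, with `P_X` a probability distribution on `X`
and every `ρ_E^x` a state. -/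
def IsCQState {X E : Type*} [Fintype X] [DecidableEq X] [Fintype E]
    (ρ : Matrix (X × E) (X × E) ℂ) : Prop :=
  ∃ (P : X → ℝ) (ρE : X → Matrix E E ℂ), (∀ x, 0 ≤ P x) ∧ ∑ x, P x = 1 ∧
    (∀ x, IsState (ρE x)) ∧
    ρ = ∑ x, (P x : ℂ) • (Matrix.single x x (1 : ℂ) ⊗ₖ ρE x)

/-- The state `ρ_{f(X)E}` that results when the classical register `X` of `ρ_XE` is processed by
the function `f`: the term `|x⟩⟨x| ⊗ P_X(x) ρ_E^x` becomes `|f x⟩⟨f x| ⊗ P_X(x) ρ_E^x`.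
For a projection `f` this traces out the other classical registers. -/
def mapClassical {X Y E : Type*} [Fintype X] [DecidableEq Y] (f : X → Y)
    (ρ : Matrix (X × E) (X × E) ℂ) : Matrix (Y × E) (Y × E) ℂ :=
  ∑ x, Matrix.single (f x) (f x) (1 : ℂ) ⊗ₖ (Matrix.of fun e e' => ρ (x, e) (x, e'))

/-- The joint state `ρ_{A₀B₀} ⊗ ρ_{A₁B₁}` of two independent bipartite systems, with the systems
arranged in the order `A₀ A₁ B₀ B₁`. -/
def indepState {A₀ A₁ B₀ B₁ : Type*} (ρ₀ : Matrix (A₀ × B₀) (A₀ × B₀) ℂ)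
    (ρ₁ : Matrix (A₁ × B₁) (A₁ × B₁) ℂ) :
    Matrix ((A₀ × A₁) × (B₀ × B₁)) ((A₀ × A₁) × (B₀ × B₁)) ℂ :=
  Matrix.reindex (Equiv.prodProdProdComm A₀ B₀ A₁ B₁) (Equiv.prodProdProdComm A₀ B₀ A₁ B₁)
    (ρ₀ ⊗ₖ ρ₁)

/-- The `L₁`-norm `‖M‖₁ = Tr √(M† M)`. -/
def traceNorm {A : Type*} [Fintype A] [DecidableEq A] (M : Matrix A A ℂ) : ℝ :=
  (CFC.sqrt (M.conjTranspose * M)).trace.re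

/-- The fidelity `F(ρ, σ) = ‖√ρ √σ‖₁`. -/
def fidelity {A : Type*} [Fintype A] [DecidableEq A] (ρ σ : Matrix A A ℂ) : ℝ :=
  traceNorm (CFC.sqrt ρ * CFC.sqrt σ)

/-- The distance `C(ρ, σ) = √(1 - F(ρ, σ)²)`. -/
def cDist {A : Type*} [Fintype A] [DecidableEq A] (ρ σ : Matrix A A ℂ) : ℝ :=
  √(1 - fidelity ρ σ ^ 2)

/-- The ball `K^ε(ρ)` of positive operators of trace at most one that are `ε`-close to `ρ`. -/
def smoothingBall {A : Type*} [Fintype A] [DecidableEq A] (ε : ℝ) (ρ : Matrix A A ℂ) :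
    Set (Matrix A A ℂ) :=
  {τ | τ.PosSemidef ∧ cDist ρ τ ≤ ε ∧ τ.trace.re ≤ 1}

/-- The optimal value `min Tr(σ_B)` over `σ_B ≥ 0` with `ρ_AB ≤ id_A ⊗ σ_B`. -/
def minEntropyValue {A B : Type*} [DecidableEq A] [Fintype B]
    (ρ : Matrix (A × B) (A × B) ℂ) : ℝ :=
  sInf {t : ℝ | ∃ σ : Matrix B B ℂ, σ.PosSemidef ∧
    ((1 : Matrix A A ℂ) ⊗ₖ σ - ρ).PosSemidef ∧ t = σ.trace.re}

/-- The conditional min-entropy `H_∞(A|B)_ρ = -log₂ min Tr(σ_B)`; it is `+∞` if the minimum is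
zero, which happens for `ρ = 0`. -/
def minEntropy {A B : Type*} [DecidableEq A] [Fintype B]
    (ρ : Matrix (A × B) (A × B) ℂ) : EReal :=
  if minEntropyValue ρ = 0 then ⊤ else ((-Real.logb 2 (minEntropyValue ρ) : ℝ) : EReal)

/-- The `ε`-smooth conditional min-entropy `H_∞^ε(A|B)_ρ`. -/
def smoothMinEntropy {A B : Type*} [Fintype A] [DecidableEq A] [Fintype B] [DecidableEq B]
    (ε : ℝ) (ρ : Matrix (A × B) (A × B) ℂ) : EReal :=
  ⨆ τ ∈ smoothingBall ε ρ, minEntropy τ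

/-- The string `S` ranges over `{0,1}^ℓ`. -/
abbrev BitString (ℓ : ℕ) : Type := Fin ℓ → Bool

/-- The value of the registers `(X_{D̄}, D, S_D)` when `D = d`, as a function of the registers
`X₀ X₁ S₀ S₁`; the bit `0` is `false` and `1` is `true`. -/
def selectRegisters {X₀ X₁ S : Type*} (d : Bool) (z : (X₀ × X₁) × (S × S)) :
    (X₀ ⊕ X₁) × Bool × S :=
  match d with
  | false => (Sum.inr z.1.2, false, z.2.1)
  | true => (Sum.inl z.1.1, true, z.2.2)

end

/-! An operator `τ` has guessing bound `λ` if `τ ≤ id ⊗ σ` with `Tr σ ≤ λ`, so that its min-entropy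
is at least `-log λ`. For a positive `M` and `q ∈ (0, 1]` with `λ Tr_A M ≤ 1 - q`, every
subnormalized `τ` of guessing bound `λ` has `Tr(τ (M + q)) ≤ 1`, whence `F(ρ, τ)² ≤ Tr(ρ (M + q)⁻¹)`
by Cauchy-Schwarz. Choose `(M, q)` minimizing this bound. The first-order conditions at the
minimum say, by duality, that the filter `Z ∝ (M + q)⁻¹` attains it: `ZρZ` is subnormalized, has
guessing bound essentially `λ`, and `F(ρ, ZρZ)² = Tr(ρ (M + q)⁻¹)`. So either `ρ` can be smoothed
by a filter, or the minimal value `a` is less than `1 - ε²`.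

Suppose neither state can be smoothed by a filter at `λ = 2^(-α/2)`. The pair
`(M₀ ⊗ M₁, 1 - (1 - q₀)(1 - q₁))` is feasible for the product of the two bounds. One Newton step for
its inverse, starting from `(M₀ + q₀)⁻¹ ⊗ (M₁ + q₁)⁻¹`, bounds its value by
`1 - (1 - a₀)(1 - a₁) < 1 - ε⁴`, which contradicts the smooth min-entropy of the product state.

If it is `X_i` that can be smoothed, take `D = 1 - i`. Filters are what makes this survive the
passage to `X_i D S_D`: since `X_i` is a function of the larger register, the diagonal blocks of
the filter can be pulled back along that function, and refining a classical register only
decreases each block, so the guessing bound is preserved. -/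

open Matrix Filter Topology

section Expectation

variable {n m : Type*} [Fintype n]

/-- The real bilinear pairing `Re Tr(ρX)`, which for Hermitian `X` is the expectation of the
observable `X` in the state `ρ`. -/
noncomputable def expectation : LinearMap.BilinForm ℝ (Matrix n n ℂ) :=
  (LinearMap.mul ℝ (Matrix n n ℂ)).compr₂ (Complex.reLm ∘ₗ traceLinearMap n ℝ ℂ)

theorem expectation_apply (ρ X : Matrix n n ℂ) : expectation ρ X = (ρ * X).trace.re := rfl

theorem expectation_comm (ρ X : Matrix n n ℂ) : expectation ρ X = expectation X ρ := by
  rw [expectation_apply, trace_mul_comm, expectation_apply]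

theorem expectation_conj (ρ X Z : Matrix n n ℂ) :
    expectation (Z * ρ * Z) X = expectation ρ (Z * X * Z) := by
  simp only [expectation_apply, Matrix.mul_assoc]
  rw [trace_mul_comm]
  simp only [Matrix.mul_assoc]

theorem trace_submatrix_equiv [Fintype m] (M : Matrix n n ℂ) (e : m ≃ n) :
    (M.submatrix e e).trace = M.trace :=
  Equiv.sum_comp e fun i ↦ M i i

theorem expectation_submatrix_equiv [Fintype m] (ρ X : Matrix n n ℂ) (e : m ≃ n) :
    expectation (ρ.submatrix e e) (X.submatrix e e) = expectation ρ X := by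
  rw [expectation_apply, submatrix_mul_equiv, trace_submatrix_equiv, expectation_apply]

theorem re_trace_conjTranspose (M : Matrix n n ℂ) : Mᴴ.trace.re = M.trace.re := by
  rw [trace_conjTranspose, Complex.star_def, Complex.conj_re]

theorem continuous_expectation (ρ : Matrix n n ℂ) : Continuous (expectation ρ) :=
  (expectation ρ).continuous_of_finiteDimensional

theorem re_trace_nonneg {M : Matrix n n ℂ} (hM : M.PosSemidef) : 0 ≤ M.trace.re :=
  (Complex.le_def.1 hM.trace_nonneg).1

omit [Fintype n] in
theorem posSemidef_real_smul {M : Matrix n n ℂ} (hM : M.PosSemidef) {c : ℝ} (hc : 0 ≤ c) :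
    (c • M).PosSemidef :=
  hM.smul hc

theorem conj_posSemidef {M Z : Matrix n n ℂ} (hM : M.PosSemidef) (hZ : Z.IsHermitian) :
    (Z * M * Z).PosSemidef := by
  simpa only [hZ.eq] using hM.mul_mul_conjTranspose_same Z

theorem mul_self_posSemidef {Z : Matrix n n ℂ} (hZ : Z.IsHermitian) : (Z * Z).PosSemidef := by
  simpa only [hZ.eq] using posSemidef_self_mul_conjTranspose Z

variable [DecidableEq n]

theorem expectation_one (ρ : Matrix n n ℂ) : expectation ρ 1 = ρ.trace.re := by
  rw [expectation_apply, Matrix.mul_one]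

theorem sqrt_posSemidef (M : Matrix n n ℂ) : (CFC.sqrt M).PosSemidef :=
  nonneg_iff_posSemidef.1 (CFC.sqrt_nonneg M)

theorem sqrt_mul_sqrt {M : Matrix n n ℂ} (hM : M.PosSemidef) : CFC.sqrt M * CFC.sqrt M = M :=
  CFC.sqrt_mul_sqrt_self M hM.nonneg

omit [DecidableEq n] in
theorem expectation_nonneg {ρ X : Matrix n n ℂ} (hρ : ρ.PosSemidef) (hX : X.PosSemidef) :
    0 ≤ expectation ρ X := by
  classical
  have h := re_trace_nonneg (conj_posSemidef hρ (sqrt_posSemidef X).1)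
  rwa [← expectation_one, expectation_conj, Matrix.mul_one, sqrt_mul_sqrt hX] at h

omit [DecidableEq n] in
theorem expectation_mono {ρ X Y : Matrix n n ℂ} (hρ : ρ.PosSemidef) (h : (Y - X).PosSemidef) :
    expectation ρ X ≤ expectation ρ Y := by
  simpa only [map_sub, sub_nonneg] using expectation_nonneg hρ h

omit [Fintype n] in
theorem posDef_add_smul_one {M : Matrix n n ℂ} (hM : M.PosSemidef) {q : ℝ} (hq : 0 < q) :
    (M + q • 1).PosDef :=
  PosDef.posSemidef_add hM (PosDef.one.smul hq)

theorem isUnit_det {K : Matrix n n ℂ} (hK : K.PosDef) : IsUnit K.det :=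
  (isUnit_iff_isUnit_det _).1 hK.isUnit

end Expectation

section Fidelity

variable {n : Type*} [Fintype n]

theorem re_trace_mul_sq_le (P Q : Matrix n n ℂ) :
    (P * Q).trace.re ^ 2 ≤ (P * Pᴴ).trace.re * (Qᴴ * Q).trace.re := by
  have quadratic_nonneg (t : ℝ) : 0 ≤ (P * Pᴴ).trace.re * (t * t) + 2 * (P * Q).trace.re * t
      + (Qᴴ * Q).trace.re := by
    have h := re_trace_nonneg (posSemidef_conjTranspose_mul_self (t • Pᴴ + Q))
    have cross : (Qᴴ * Pᴴ).trace.re = (P * Q).trace.re := by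
      rw [← conjTranspose_mul, re_trace_conjTranspose]
    simp only [conjTranspose_add, conjTranspose_smul, conjTranspose_conjTranspose, star_trivial,
      add_mul, mul_add, trace_add, Complex.add_re, smul_mul_assoc, mul_smul_comm, trace_smul,
      Complex.smul_re, smul_eq_mul, cross] at h
    linarith
  have := discrim_le_zero quadratic_nonneg
  unfold discrim at this
  nlinarith

variable [DecidableEq n]

theorem re_trace_sqrt_sq_le {X Y : Matrix n n ℂ} (hX : X.PosSemidef) (hY : Y.PosDef) :
    (CFC.sqrt X).trace.re ^ 2 ≤ expectation X Y⁻¹ * Y.trace.re := by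
  have hXh := (sqrt_posSemidef X).1
  have hYh := (sqrt_posSemidef Y).1
  have hYY := sqrt_mul_sqrt hY.posSemidef
  have hdet : IsUnit (CFC.sqrt Y).det :=
    isUnit_of_mul_isUnit_left (y := (CFC.sqrt Y).det) (by
      rw [← det_mul, hYY]; exact isUnit_det hY)
  have h := re_trace_mul_sq_le (CFC.sqrt X * (CFC.sqrt Y)⁻¹) (CFC.sqrt Y)
  rw [nonsing_inv_mul_cancel_right _ _ hdet, hYh.eq, hYY, conjTranspose_mul, hXh.eq, hYh.inv.eq,
    Matrix.mul_assoc, ← Matrix.mul_assoc (CFC.sqrt Y)⁻¹, ← Matrix.mul_inv_rev, hYY,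
    trace_mul_comm, Matrix.mul_assoc, sqrt_mul_sqrt hX, ← expectation_apply, expectation_comm] at h
  exact h

theorem inv_sub_conj_inv_posSemidef {K T : Matrix n n ℂ} (hK : K.PosDef) (hT : T.IsHermitian)
    {δ : ℝ} (hδ : 0 < δ) : (K⁻¹ - T * (T * K * T + δ • 1)⁻¹ * T).PosSemidef := by
  have hY := posDef_add_smul_one (conj_posSemidef hK.posSemidef hT) hδ
  let := hK.inv.isUnit.invertible
  let := hY.isUnit.invertible
  have block : (fromBlocks K⁻¹ T Tᴴ (T * K * T + δ • 1)).PosSemidef := by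
    refine (PosDef.fromBlocks₁₁ T _ hK.inv).2 ?_
    rw [nonsing_inv_nonsing_inv _ (isUnit_det hK), hT.eq, add_sub_cancel_left]
    exact (PosDef.one.smul hδ).posSemidef
  simpa only [hT.eq] using (PosDef.fromBlocks₂₂ _ T hY).1 block

theorem fidelity_sq_le {ρ τ K : Matrix n n ℂ} (hρ : ρ.PosSemidef) (hτ : τ.PosSemidef)
    (hK : K.PosDef) : fidelity ρ τ ^ 2 ≤ expectation ρ K⁻¹ * expectation τ K := by
  set T := CFC.sqrt τ
  have hT : T.PosSemidef := sqrt_posSemidef τ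
  have fidelity_eq : fidelity ρ τ = (CFC.sqrt (T * ρ * T)).trace.re := by
    rw [fidelity, traceNorm, conjTranspose_mul, (sqrt_posSemidef ρ).1.eq, hT.1.eq, Matrix.mul_assoc,
      ← Matrix.mul_assoc (CFC.sqrt ρ), sqrt_mul_sqrt hρ, ← Matrix.mul_assoc]
  have trace_conj : (T * K * T).trace.re = expectation τ K := by
    rw [← expectation_one, expectation_conj, Matrix.mul_one, sqrt_mul_sqrt hτ, expectation_comm]
  have regularized (δ : ℝ) (hδ : 0 < δ) : fidelity ρ τ ^ 2 ≤
      expectation ρ K⁻¹ * (expectation τ K + δ * (1 : Matrix n n ℂ).trace.re) := by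
    have hY := posDef_add_smul_one (conj_posSemidef hK.posSemidef hT.1) hδ
    have h := re_trace_sqrt_sq_le (conj_posSemidef hρ hT.1) hY
    rw [← fidelity_eq, expectation_conj, trace_add, trace_smul, Complex.add_re, trace_conj,
      Complex.smul_re, smul_eq_mul] at h
    refine h.trans (mul_le_mul_of_nonneg_right
      (expectation_mono hρ (inv_sub_conj_inv_posSemidef hK hT.1 hδ)) ?_)
    exact add_nonneg (expectation_nonneg hτ hK.posSemidef)
      (mul_nonneg hδ.le (re_trace_nonneg PosSemidef.one))
  have limit : Tendsto (fun δ : ℝ ↦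
      expectation ρ K⁻¹ * (expectation τ K + δ * (1 : Matrix n n ℂ).trace.re)) (𝓝[>] 0)
      (𝓝 (expectation ρ K⁻¹ * expectation τ K)) :=
    tendsto_nhdsWithin_of_tendsto_nhds <| Continuous.tendsto' (by fun_prop) _ _ (by simp)
  exact ge_of_tendsto limit (eventually_mem_nhdsWithin.mono regularized)

theorem trace_cfc_eq_of_charpoly_eq {M N : Matrix n n ℂ} (hM : M.IsHermitian)
    (hN : N.IsHermitian) (h : M.charpoly = N.charpoly) (f : ℝ → ℝ) :
    (cfc f M).trace = (cfc f N).trace := by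
  rw [trace_eq_sum_roots_charpoly, trace_eq_sum_roots_charpoly, hM.charpoly_cfc_eq,
    hN.charpoly_cfc_eq, (hM.eigenvalues_eq_eigenvalues_iff hN).2 h]

theorem traceNorm_conjTranspose (M : Matrix n n ℂ) : traceNorm Mᴴ = traceNorm M := by
  have h := posSemidef_self_mul_conjTranspose M
  have h' := posSemidef_conjTranspose_mul_self M
  rw [traceNorm, traceNorm, conjTranspose_conjTranspose, CFC.sqrt_eq_real_sqrt _ h.nonneg,
    CFC.sqrt_eq_real_sqrt _ h'.nonneg, cfcₙ_eq_cfc, cfcₙ_eq_cfc,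
    trace_cfc_eq_of_charpoly_eq h.1 h'.1 (charpoly_mul_comm _ _)]

theorem fidelity_comm (ρ τ : Matrix n n ℂ) : fidelity ρ τ = fidelity τ ρ := by
  rw [fidelity, ← traceNorm_conjTranspose, conjTranspose_mul, (sqrt_posSemidef ρ).1.eq,
    (sqrt_posSemidef τ).1.eq, fidelity]

theorem fidelity_conj {ρ Z : Matrix n n ℂ} (hρ : ρ.PosSemidef) (hZ : Z.PosSemidef) :
    fidelity ρ (Z * ρ * Z) = expectation ρ Z := by
  set R := CFC.sqrt ρ
  have hR : R.PosSemidef := sqrt_posSemidef ρ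
  have hRR : R * R = ρ := sqrt_mul_sqrt hρ
  have square : (CFC.sqrt (Z * ρ * Z) * R)ᴴ * (CFC.sqrt (Z * ρ * Z) * R)
      = (R * Z * R) * (R * Z * R) := by
    calc _ = R * (CFC.sqrt (Z * ρ * Z) * CFC.sqrt (Z * ρ * Z)) * R := by
          rw [conjTranspose_mul, hR.1.eq, (sqrt_posSemidef _).1.eq]; simp only [Matrix.mul_assoc]
      _ = R * (Z * (R * R) * Z) * R := by
          rw [sqrt_mul_sqrt (conj_posSemidef hρ hZ.1), hRR]
      _ = _ := by simp only [Matrix.mul_assoc]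
  rw [fidelity_comm, fidelity, traceNorm, square,
    CFC.sqrt_mul_self _ (conj_posSemidef hZ hR.1).nonneg, ← expectation_one, expectation_conj,
    Matrix.mul_one, hRR, expectation_comm]

end Fidelity

section ConicDuality

variable {n A B : Type*} [Fintype n] [Fintype A] [Fintype B]

omit [Fintype n] in
theorem isClosed_posSemidef [Finite n] : IsClosed {M : Matrix n n ℂ | M.PosSemidef} := by
  cases nonempty_fintype n
  have : {M : Matrix n n ℂ | M.PosSemidef}
      = {M | Mᴴ = M} ∩ ⋂ x : n → ℂ, {M | 0 ≤ star x ⬝ᵥ (M *ᵥ x)} := by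
    ext M
    simp [posSemidef_iff_dotProduct_mulVec, IsHermitian]
  rw [this]
  refine IsClosed.inter (isClosed_eq (by fun_prop) continuous_id) (isClosed_iInter fun x ↦ ?_)
  exact isClosed_le continuous_const (by fun_prop)

omit [Fintype n] in
theorem convex_posSemidef : Convex ℝ {M : Matrix n n ℂ | M.PosSemidef} :=
  fun _ hM _ hN _ _ ha hb _ ↦ (posSemidef_real_smul hM ha).add (posSemidef_real_smul hN hb)

theorem norm_apply_le_re_trace {M : Matrix n n ℂ} (hM : M.PosSemidef) (i j : n) :
    ‖M i j‖ ≤ M.trace.re := by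
  have minor := (Complex.le_def.1 (hM.submatrix ![i, j]).det_nonneg).1
  have diag_nonneg (k : n) : 0 ≤ (M k k).re := (Complex.le_def.1 hM.diag_nonneg).1
  have diag_le (k : n) : (M k k).re ≤ M.trace.re := by
    rw [trace, Complex.re_sum]
    exact Finset.single_le_sum (f := fun k ↦ (M k k).re) (fun l _ ↦ diag_nonneg l)
      (Finset.mem_univ k)
  have diag_im (k : n) : (M k k).im = 0 := (Complex.le_def.1 hM.diag_nonneg).2.symm
  rw [det_fin_two] at minor
  simp only [submatrix_apply, cons_val_zero, cons_val_one, ← hM.1.apply j i, Complex.star_def,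
    Complex.mul_conj, Complex.normSq_eq_norm_sq, Complex.sub_re, Complex.mul_re, diag_im,
    Complex.ofReal_re, Complex.zero_re] at minor
  refine abs_le_of_sq_le_sq' ?_ (re_trace_nonneg hM) |>.2
  nlinarith [diag_nonneg i, diag_nonneg j, diag_le i, diag_le j]

theorem continuous_re_trace : Continuous fun M : Matrix n n ℂ ↦ M.trace.re :=
  Complex.continuous_re.comp continuous_id.matrix_trace

theorem isCompact_posSemidef_re_trace_le (t : ℝ) :
    IsCompact {M : Matrix n n ℂ | M.PosSemidef ∧ M.trace.re ≤ t} := by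
  have box : IsCompact (Set.univ.pi fun _ : n ↦ Set.univ.pi fun _ : n ↦
      Metric.closedBall (0 : ℂ) t) :=
    isCompact_univ_pi fun _ ↦ isCompact_univ_pi fun _ ↦ isCompact_closedBall _ _
  refine box.of_isClosed_subset (isClosed_posSemidef.inter
    (isClosed_le continuous_re_trace continuous_const)) ?_
  rintro M ⟨hM, ht⟩ i - j -
  rw [mem_closedBall_zero_iff]
  exact (norm_apply_le_re_trace hM i j).trans ht

theorem convex_posSemidef_re_trace_le (t : ℝ) :
    Convex ℝ {M : Matrix n n ℂ | M.PosSemidef ∧ M.trace.re ≤ t} :=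
  convex_posSemidef.inter
    (convex_halfSpace_le (Complex.reLm ∘ₗ traceLinearMap n ℝ ℂ).isLinear t)

theorem posSemidef_of_forall_state {H : Matrix n n ℂ} (hH : H.IsHermitian)
    (h : ∀ σ : Matrix n n ℂ, IsState σ → 0 ≤ expectation H σ) : H.PosSemidef := by
  refine .of_dotProduct_mulVec_nonneg hH fun x ↦ ?_
  rcases eq_or_ne x 0 with rfl | hx
  · simp
  have norm_pos : 0 < x ⬝ᵥ star x := by
    simpa only [dotProduct_comm] using dotProduct_star_self_pos_iff.2 hx
  obtain ⟨r, hr, hrx⟩ := RCLike.pos_iff_exists_ofReal.1 norm_pos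
  have state : IsState (r⁻¹ • vecMulVec x (star x)) := by
    refine ⟨posSemidef_real_smul (posSemidef_vecMulVec_self_star x) (inv_nonneg.2 hr.le), ?_⟩
    rw [trace_smul, trace_vecMulVec, ← hrx, Complex.real_smul, Complex.ofReal_inv]
    exact inv_mul_cancel₀ (Complex.ofReal_ne_zero.2 hr.ne')
  have pairing : expectation H (vecMulVec x (star x)) = (star x ⬝ᵥ (H *ᵥ x)).re := by
    rw [expectation_apply, mul_vecMulVec, trace_vecMulVec, dotProduct_comm]
  have h_nonneg := h _ state
  rw [map_smul, pairing, smul_eq_mul] at h_nonneg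
  exact Complex.le_def.2 ⟨(mul_nonneg_iff_of_pos_left (inv_pos.2 hr)).1 h_nonneg,
    (hH.im_star_dotProduct_mulVec_self x).symm⟩

theorem nondegenerate_expectation :
    (expectation : LinearMap.BilinForm ℝ (Matrix n n ℂ)).Nondegenerate := by
  have separating (ρ : Matrix n n ℂ) (h : expectation ρ ρᴴ = 0) : ρ = 0 := by
    have hρ := posSemidef_self_mul_conjTranspose ρ
    rw [← self_mul_conjTranspose_eq_zero, ← hρ.trace_eq_zero_iff]
    exact Complex.ext h (Complex.le_def.1 hρ.trace_nonneg).2.symm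
  refine ⟨fun ρ h ↦ separating ρ (h _), fun ρ h ↦ separating ρ ?_⟩
  rw [expectation_comm]
  exact h _

theorem exists_isHermitian_forall_eq_expectation (f : Module.Dual ℝ (Matrix n n ℂ)) :
    ∃ H : Matrix n n ℂ, H.IsHermitian ∧ ∀ X : Matrix n n ℂ, X.IsHermitian →
      f X = expectation H X := by
  set G := (expectation.toDual nondegenerate_expectation).symm f
  have hG (X : Matrix n n ℂ) : expectation G X = f X := by
    rw [← LinearMap.BilinForm.toDual_def nondegenerate_expectation, LinearEquiv.apply_symm_apply]
  refine ⟨(1 / 2 : ℝ) • (G + Gᴴ), ?_, fun X hX ↦ ?_⟩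
  · rw [IsHermitian, conjTranspose_smul, conjTranspose_add, conjTranspose_conjTranspose, add_comm,
      star_trivial]
  · have adjoint_eq : expectation Gᴴ X = expectation G X := by
      rw [expectation_apply, ← re_trace_conjTranspose, conjTranspose_mul,
        conjTranspose_conjTranspose, hX.eq, ← expectation_apply, expectation_comm]
    simp only [map_smul, map_add, LinearMap.smul_apply, LinearMap.add_apply, adjoint_eq, hG,
      smul_eq_mul]
    ring

theorem exists_posSemidef_separating {T : Set (Matrix n n ℂ)} (hT : IsCompact T)
    (hconv : Convex ℝ T) (hherm : ∀ X ∈ T, X.IsHermitian) (hdisj : ∀ X ∈ T, ¬ X.PosSemidef) :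
    ∃ H : Matrix n n ℂ, H.PosSemidef ∧ ∃ u < 0, ∀ X ∈ T, expectation H X ≤ u := by
  have : LocallyConvexSpace ℝ (Matrix n n ℂ) := inferInstanceAs (LocallyConvexSpace ℝ (n → n → ℂ))
  obtain ⟨f, u, v, hu, huv, hv⟩ := geometric_hahn_banach_compact_closed hconv hT
    convex_posSemidef isClosed_posSemidef (Set.disjoint_left.2 hdisj)
  obtain ⟨H, hH, hfH⟩ := exists_isHermitian_forall_eq_expectation f.toLinearMap
  have hv₀ : v < 0 := by simpa using hv 0 PosSemidef.zero
  refine ⟨H, posSemidef_of_forall_state hH fun σ hσ ↦ ?_, u, huv.trans hv₀, fun X hX ↦ ?_⟩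
  · rw [← hfH σ hσ.1.1]
    by_contra! hneg
    have h := hv _ (posSemidef_real_smul hσ.1 (div_nonneg_of_nonpos hv₀.le hneg.le))
    rw [map_smul, smul_eq_mul] at h
    exact h.ne' (div_mul_cancel₀ _ hneg.ne)
  · exact (hfH X (hherm X hX)).symm.le.trans (hu X hX).le

/-- The operator `⟨a| M |a⟩` on the right factor of a bipartite system. For a cq-state it is
`P_X(a) ρ_E^a`. -/
def diagBlock (M : Matrix (A × B) (A × B) ℂ) (a : A) : Matrix B B ℂ :=
  M.submatrix (Prod.mk a) (Prod.mk a)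

/-- The partial trace over the left factor of a bipartite system. -/
noncomputable def partialTrace : Matrix (A × B) (A × B) ℂ →ₗ[ℝ] Matrix B B ℂ where
  toFun M := ∑ a, diagBlock M a
  map_add' M N := Finset.sum_add_distrib
  map_smul' c M := by
    simp only [diagBlock, submatrix_smul, Pi.smul_apply, Finset.smul_sum, RingHom.id_apply]

omit [Fintype B] in
theorem partialTrace_apply (M : Matrix (A × B) (A × B) ℂ) :
    partialTrace M = ∑ a, diagBlock M a := rfl

omit [Fintype A] [Fintype B] in
theorem diagBlock_posSemidef {M : Matrix (A × B) (A × B) ℂ} (hM : M.PosSemidef) (a : A) :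
    (diagBlock M a).PosSemidef :=
  hM.submatrix _

omit [Fintype B] in
theorem partialTrace_posSemidef {M : Matrix (A × B) (A × B) ℂ} (hM : M.PosSemidef) :
    (partialTrace M).PosSemidef :=
  posSemidef_sum _ fun a _ ↦ diagBlock_posSemidef hM a

theorem trace_partialTrace (M : Matrix (A × B) (A × B) ℂ) : (partialTrace M).trace = M.trace := by
  rw [partialTrace_apply, trace_sum]
  exact (Fintype.sum_prod_type fun p ↦ M p p).symm

variable [DecidableEq A]

theorem partialTrace_one_kronecker_mul (σ : Matrix B B ℂ) (M : Matrix (A × B) (A × B) ℂ) :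
    partialTrace (((1 : Matrix A A ℂ) ⊗ₖ σ) * M) = σ * partialTrace M := by
  simp only [partialTrace_apply, Finset.mul_sum]
  refine Finset.sum_congr rfl fun a _ ↦ ?_
  ext b b'
  simp [diagBlock, mul_apply, Fintype.sum_prod_type, one_apply]

theorem expectation_one_kronecker (σ : Matrix B B ℂ) (M : Matrix (A × B) (A × B) ℂ) :
    expectation ((1 : Matrix A A ℂ) ⊗ₖ σ) M = expectation σ (partialTrace M) := by
  rw [expectation_apply, ← trace_partialTrace, partialTrace_one_kronecker_mul, expectation_apply]

/-- The operator `τ_AB` satisfies `τ_AB ≤ id_A ⊗ σ_B` for some `σ_B ≥ 0` of trace at most `lam`.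
For classical `A` the least such `lam` is the probability of guessing `A` from `B`. -/
def HasGuessingBound (τ : Matrix (A × B) (A × B) ℂ) (lam : ℝ) : Prop :=
  ∃ σ : Matrix B B ℂ, σ.PosSemidef ∧ ((1 : Matrix A A ℂ) ⊗ₖ σ - τ).PosSemidef ∧ σ.trace.re ≤ lam

theorem exists_separating_of_not_hasGuessingBound {τ : Matrix (A × B) (A × B) ℂ}
    (hτ : τ.IsHermitian) {κ : ℝ} (hτκ : ¬ HasGuessingBound τ κ) :
    ∃ H : Matrix (A × B) (A × B) ℂ, H.PosSemidef ∧ ∃ u < 0, ∀ σ : Matrix B B ℂ, σ.PosSemidef →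
      σ.trace.re ≤ κ → expectation σ (partialTrace H) ≤ expectation τ H + u := by
  set slack : Matrix B B ℂ →ᵃ[ℝ] Matrix (A × B) (A × B) ℂ :=
    (kroneckerBilinear (R := ℝ) (1 : Matrix A A ℂ)).toAffineMap - AffineMap.const ℝ _ τ
  have slack_apply (σ : Matrix B B ℂ) : slack σ = (1 : Matrix A A ℂ) ⊗ₖ σ - τ := rfl
  have slack_continuous : Continuous slack :=
    (LinearMap.continuous_of_finiteDimensional _).sub continuous_const
  obtain ⟨H, hH, u, hu, hHu⟩ := exists_posSemidef_separating
    (T := slack '' {σ | σ.PosSemidef ∧ σ.trace.re ≤ κ})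
    ((isCompact_posSemidef_re_trace_le κ).image slack_continuous)
    ((convex_posSemidef_re_trace_le κ).affine_image slack)
    (by rintro _ ⟨σ, hσ, rfl⟩; exact (PosSemidef.one.kronecker hσ.1).1.sub hτ)
    (by rintro _ ⟨σ, hσ, rfl⟩ hP; exact hτκ ⟨σ, hσ.1, hP, hσ.2⟩)
  refine ⟨H, hH, u, hu, fun σ hσ hσκ ↦ ?_⟩
  have := hHu _ ⟨σ, ⟨hσ, hσκ⟩, rfl⟩
  rw [slack_apply, map_sub, expectation_comm, expectation_one_kronecker,
    expectation_comm H] at this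
  linarith

theorem hasGuessingBound_of_forall_dual [DecidableEq B] {τ : Matrix (A × B) (A × B) ℂ}
    (hτ : τ.IsHermitian) {κ : ℝ} (hκ : 0 < κ)
    (h : ∀ M : Matrix (A × B) (A × B) ℂ, M.PosSemidef → (1 - partialTrace M).PosSemidef →
      expectation τ M ≤ κ) : HasGuessingBound τ κ := by
  by_contra hτκ
  obtain ⟨H, hH, u, hu, bound⟩ := exists_separating_of_not_hasGuessingBound hτ hτκ
  set t := expectation τ H
  have ht : 0 ≤ t + u := by simpa using bound 0 PosSemidef.zero (by simpa using hκ.le)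
  set s := (t + u / 2) / κ
  have hs : 0 < s := div_pos (by linarith) hκ
  have hsκ : s * κ = t + u / 2 := div_mul_cancel₀ _ hκ.ne'
  have hM := posSemidef_real_smul hH (inv_nonneg.2 hs.le)
  have feasible : (1 - partialTrace (s⁻¹ • H)).PosSemidef := by
    refine posSemidef_of_forall_state
      (isHermitian_one.sub (partialTrace_posSemidef hM).1) fun σ hσ ↦ ?_
    have hκσ := bound (κ • σ) (posSemidef_real_smul hσ.1 hκ.le) (by simp [hσ.2])
    rw [map_smul, LinearMap.smul_apply, smul_eq_mul] at hκσ
    have : expectation σ (partialTrace H) ≤ s := le_of_mul_le_mul_left (by linarith) hκ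
    rw [expectation_comm, map_sub, expectation_one, hσ.2, map_smul, map_smul, smul_eq_mul,
      Complex.one_re, sub_nonneg, inv_mul_le_iff₀ hs, mul_one]
    exact this
  have := h _ hM feasible
  rw [map_smul, smul_eq_mul, inv_mul_le_iff₀ hs, hsκ] at this
  linarith

end ConicDuality

section InverseMinimization

variable {n : Type*} [Fintype n] [DecidableEq n]

theorem continuousAt_inv_posDef {K : Matrix n n ℂ} (hK : K.PosDef) :
    ContinuousAt (fun X : Matrix n n ℂ ↦ X⁻¹) K :=
  continuousAt_matrix_inv K <| by
    simpa only [Ring.inverse_eq_inv'] using continuousAt_inv₀ (isUnit_det hK).ne_zero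

theorem inv_sub_inv_eq {K L : Matrix n n ℂ} (hK : K.PosDef) (hL : L.PosDef) :
    K⁻¹ - L⁻¹ = K⁻¹ * (L - K) * L⁻¹ := by
  rw [Matrix.mul_sub, Matrix.sub_mul, mul_nonsing_inv_cancel_right _ _ (isUnit_det hL),
    nonsing_inv_mul _ (isUnit_det hK), Matrix.one_mul]

theorem expectation_conj_inv_le_of_forall_segment {ρ K L : Matrix n n ℂ} (hK : K.PosDef)
    (hL : L.PosDef) (hmin : ∀ t : ℝ, 0 < t → t < 1 →
      expectation ρ K⁻¹ ≤ expectation ρ (K + t • (L - K))⁻¹) :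
    expectation (K⁻¹ * ρ * K⁻¹) L ≤ expectation ρ K⁻¹ := by
  set W : ℝ → Matrix n n ℂ := fun t ↦ K + t • (L - K)
  have hW₀ : W 0 = K := by simp [W]
  have derivative : Tendsto (fun t ↦ expectation ρ (K⁻¹ * (L - K) * (W t)⁻¹)) (𝓝[>] 0)
      (𝓝 (expectation ρ (K⁻¹ * (L - K) * K⁻¹))) := by
    have inv_tendsto : Tendsto (fun t ↦ (W t)⁻¹) (𝓝 0) (𝓝 K⁻¹) := by
      have hW : ContinuousAt W 0 := by fun_prop
      have := ContinuousAt.comp (g := fun X : Matrix n n ℂ ↦ X⁻¹) (f := W)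
        (by rw [hW₀]; exact continuousAt_inv_posDef hK) hW
      simpa only [ContinuousAt, Function.comp_def, hW₀] using this
    exact (((continuous_expectation ρ).tendsto _).comp
      (inv_tendsto.const_mul _)).mono_left nhdsWithin_le_nhds
  have derivative_nonpos : expectation ρ (K⁻¹ * (L - K) * K⁻¹) ≤ 0 := by
    refine le_of_tendsto derivative ?_
    filter_upwards [Ioo_mem_nhdsGT (zero_lt_one' ℝ)] with t ⟨ht₀, ht₁⟩
    have hW : (W t).PosDef := by
      have : W t = (1 - t) • K + t • L := by simp only [W]; module
      exact this ▸ (hK.smul (sub_pos.2 ht₁)).add (hL.smul ht₀)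
    have h : expectation ρ (K⁻¹ - (W t)⁻¹) ≤ 0 := by
      rw [map_sub]
      exact sub_nonpos.2 (hmin t ht₀ ht₁)
    rw [inv_sub_inv_eq hK hW, show W t - K = t • (L - K) from add_sub_cancel_left _ _,
      Matrix.mul_smul, Matrix.smul_mul, map_smul, smul_eq_mul] at h
    exact nonpos_of_mul_nonpos_right h ht₀
  rwa [Matrix.mul_sub, Matrix.sub_mul, nonsing_inv_mul _ (isUnit_det hK), Matrix.one_mul, map_sub,
    sub_nonpos, ← expectation_conj] at derivative_nonpos

theorem exists_forall_expectation_conj_inv_le {𝒦 : Set (Matrix n n ℂ)} (hne : 𝒦.Nonempty)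
    (hcomp : IsCompact 𝒦) (hconv : Convex ℝ 𝒦) (hpos : ∀ K ∈ 𝒦, K.PosDef) (ρ : Matrix n n ℂ) :
    ∃ K ∈ 𝒦, ∀ L ∈ 𝒦, expectation (K⁻¹ * ρ * K⁻¹) L ≤ expectation ρ K⁻¹ := by
  have hcont : ContinuousOn (fun K : Matrix n n ℂ ↦ expectation ρ K⁻¹) 𝒦 := fun K hK ↦
    ((continuous_expectation ρ).continuousAt.comp
      (continuousAt_inv_posDef (hpos K hK))).continuousWithinAt
  obtain ⟨K, hK, hmin⟩ := hcomp.exists_isMinOn hne hcont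
  refine ⟨K, hK, fun L hL ↦ expectation_conj_inv_le_of_forall_segment (hpos K hK) (hpos L hL)
    fun t ht₀ ht₁ ↦ hmin (hconv.add_smul_sub_mem hK hL ⟨ht₀.le, ht₁.le⟩)⟩

end InverseMinimization

section Dichotomy

variable {A B : Type*} [Fintype A] [DecidableEq B]

/-- Feasibility of `(M, q)` for the semidefinite programme dual to maximizing the fidelity with a
given state over the subnormalized operators of guessing bound `lam`: `q` is the multiplier of the
trace constraint and `M` that of the guessing bound. The dual objective at `ρ` is
`Tr(ρ (M + q)⁻¹)`. -/
structure IsDualFeasible (lam : ℝ) (M : Matrix (A × B) (A × B) ℂ) (q : ℝ) : Prop where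
  posSemidef : M.PosSemidef
  nonneg : 0 ≤ q
  le_one : q ≤ 1
  partialTrace_le : ((1 - q) • (1 : Matrix B B ℂ) - lam • partialTrace M).PosSemidef

theorem isDualFeasible_zero_one (lam : ℝ) :
    IsDualFeasible lam (0 : Matrix (A × B) (A × B) ℂ) 1 :=
  ⟨PosSemidef.zero, zero_le_one, le_rfl, by simpa using PosSemidef.zero⟩

theorem convex_isDualFeasible (lam : ℝ) :
    Convex ℝ {p : Matrix (A × B) (A × B) ℂ × ℝ | IsDualFeasible lam p.1 p.2} := by
  rintro ⟨M, q⟩ h ⟨M', q'⟩ h' s t hs ht hst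
  refine ⟨convex_posSemidef h.posSemidef h'.posSemidef hs ht hst, ?_, ?_, ?_⟩
  · exact convex_Ici (0 : ℝ) h.nonneg h'.nonneg hs ht hst
  · exact convex_Iic (1 : ℝ) h.le_one h'.le_one hs ht hst
  · have := convex_posSemidef h.partialTrace_le h'.partialTrace_le hs ht hst
    simp only [Set.mem_ofPred_eq] at this
    convert! this using 1
    simp only [Prod.fst_add, Prod.snd_add, Prod.smul_fst, Prod.smul_snd, map_add, map_smul]
    obtain rfl : t = 1 - s := eq_sub_of_add_eq' hst
    module

theorem isCompact_isDualFeasible [Finite B] {lam : ℝ} (hlam : 0 < lam) :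
    IsCompact {p : Matrix (A × B) (A × B) ℂ × ℝ | IsDualFeasible lam p.1 p.2} := by
  cases nonempty_fintype B
  have box := (isCompact_posSemidef_re_trace_le (n := A × B)
    ((1 : Matrix B B ℂ).trace.re / lam)).prod (isCompact_Icc (a := (0 : ℝ)) (b := 1))
  have slack_continuous : Continuous fun p : Matrix (A × B) (A × B) ℂ × ℝ ↦
      (1 - p.2) • (1 : Matrix B B ℂ) - lam • partialTrace p.1 :=
    ((continuous_const.sub continuous_snd).smul continuous_const).sub
      ((partialTrace.continuous_of_finiteDimensional.comp continuous_fst).const_smul lam)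
  have closed : IsClosed {p : Matrix (A × B) (A × B) ℂ × ℝ | IsDualFeasible lam p.1 p.2} := by
    convert! (isClosed_posSemidef.preimage continuous_fst).inter
      ((isClosed_Icc (a := (0 : ℝ)) (b := 1)).preimage continuous_snd |>.inter
        (isClosed_posSemidef.preimage slack_continuous)) using 1
    exact Set.ext fun p ↦ ⟨fun h ↦ ⟨h.posSemidef, ⟨h.nonneg, h.le_one⟩, h.partialTrace_le⟩,
      fun h ↦ ⟨h.1, h.2.1.1, h.2.1.2, h.2.2⟩⟩
  refine box.of_isClosed_subset closed fun p h ↦ ⟨⟨h.posSemidef, ?_⟩, h.nonneg, h.le_one⟩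
  have h_trace := re_trace_nonneg h.partialTrace_le
  rw [trace_sub, trace_smul, trace_smul, trace_partialTrace, Complex.sub_re, Complex.smul_re,
    Complex.smul_re, smul_eq_mul, smul_eq_mul] at h_trace
  rw [le_div_iff₀ hlam]
  nlinarith [mul_nonneg h.nonneg (re_trace_nonneg (PosSemidef.one : (1 : Matrix B B ℂ).PosSemidef))]

variable [Fintype B] [DecidableEq A]

theorem exists_isDualFeasible_forall_expectation_le (ρ : Matrix (A × B) (A × B) ℂ) {lam η : ℝ}
    (hlam : 0 < lam) (hη₀ : 0 < η) (hη₁ : η ≤ 1) :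
    ∃ M q, IsDualFeasible lam M q ∧ η ≤ q ∧ ∀ M' q', IsDualFeasible lam M' q' → η ≤ q' →
      expectation ((M + q • 1)⁻¹ * ρ * (M + q • 1)⁻¹) (M' + q' • 1)
        ≤ expectation ρ (M + q • 1)⁻¹ := by
  set 𝒟 := {p : Matrix (A × B) (A × B) ℂ × ℝ | IsDualFeasible lam p.1 p.2 ∧ η ≤ p.2}
  have 𝒟_nonempty : 𝒟.Nonempty := ⟨(0, 1), isDualFeasible_zero_one lam, hη₁⟩
  have 𝒟_convex : Convex ℝ 𝒟 := (convex_isDualFeasible lam).inter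
    (convex_halfSpace_ge (LinearMap.snd ℝ _ ℝ).isLinear η)
  have 𝒟_compact : IsCompact 𝒟 :=
    (isCompact_isDualFeasible hlam).inter_right (isClosed_le continuous_const continuous_snd)
  set shift : Matrix (A × B) (A × B) ℂ × ℝ →ₗ[ℝ] Matrix (A × B) (A × B) ℂ :=
    LinearMap.id.coprod (LinearMap.toSpanSingleton ℝ _ 1)
  have shift_posDef : ∀ K ∈ shift '' 𝒟, K.PosDef := by
    rintro _ ⟨p, ⟨hp, hηp⟩, rfl⟩
    exact posDef_add_smul_one hp.posSemidef (hη₀.trans_le hηp)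
  obtain ⟨_, ⟨⟨M, q⟩, ⟨hMq, hηq⟩, rfl⟩, hopt⟩ := exists_forall_expectation_conj_inv_le
    (𝒟_nonempty.image shift)
    (𝒟_compact.image (continuous_fst.add (continuous_snd.smul continuous_const)))
    (𝒟_convex.linear_image shift) shift_posDef ρ
  exact ⟨M, q, hMq, hηq, fun M' q' h hη ↦ hopt _ ⟨(M', q'), ⟨h, hη⟩, rfl⟩⟩

/-- Some filter `Z ≥ 0` turns `ρ` into an operator `ZρZ` of trace at most one and guessing bound
`lam` whose squared fidelity `Tr(ρZ)²` with `ρ` is at least `c`. -/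
def Filterable (ρ : Matrix (A × B) (A × B) ℂ) (c lam : ℝ) : Prop :=
  ∃ Z : Matrix (A × B) (A × B) ℂ, Z.PosSemidef ∧ c ≤ expectation ρ Z ^ 2 ∧
    expectation ρ (Z * Z) ≤ 1 ∧ HasGuessingBound (Z * ρ * Z) lam

omit [DecidableEq B] in
theorem Filterable.mono {ρ : Matrix (A × B) (A × B) ℂ} {c c' lam : ℝ} (h : Filterable ρ c lam)
    (hc : c' ≤ c) : Filterable ρ c' lam :=
  let ⟨Z, hZ, hcZ, htr, hbound⟩ := h
  ⟨Z, hZ, hc.trans hcZ, htr, hbound⟩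

omit [DecidableEq B] in
theorem filterable_of_nonpos (ρ : Matrix (A × B) (A × B) ℂ) {c lam : ℝ} (hc : c ≤ 0)
    (hlam : 0 ≤ lam) : Filterable ρ c lam :=
  ⟨0, PosSemidef.zero, by simpa using hc, by simp, 0, PosSemidef.zero,
    by simpa using PosSemidef.zero, by simpa using hlam⟩

theorem filterable_of_hasGuessingBound_conj_inv {ρ K : Matrix (A × B) (A × B) ℂ} (hK : K.PosDef)
    {lam : ℝ} (hρK : 0 < expectation ρ K⁻¹)
    (htrace : expectation ρ (K⁻¹ * K⁻¹) ≤ expectation ρ K⁻¹)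
    (hbound : HasGuessingBound (K⁻¹ * ρ * K⁻¹) (expectation ρ K⁻¹ * lam)) :
    Filterable ρ (expectation ρ K⁻¹) lam := by
  set f := expectation ρ K⁻¹
  obtain ⟨σ, hσ, hσρ, htr⟩ := hbound
  have hf : (√f)⁻¹ * (√f)⁻¹ = f⁻¹ := by rw [← mul_inv, Real.mul_self_sqrt hρK.le]
  refine ⟨(√f)⁻¹ • K⁻¹, posSemidef_real_smul hK.inv.posSemidef (by positivity), ?_, ?_,
    f⁻¹ • σ, posSemidef_real_smul hσ (by positivity), ?_, ?_⟩
  · rw [map_smul, smul_eq_mul, mul_pow, sq, hf, sq, inv_mul_cancel_left₀ hρK.ne']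
  · rwa [smul_mul_smul_comm, hf, map_smul, smul_eq_mul, inv_mul_le_iff₀ hρK, mul_one]
  · rw [Matrix.smul_mul, smul_mul_smul_comm, hf, kronecker_smul, ← smul_sub]
    exact posSemidef_real_smul hσρ (by positivity)
  · rwa [trace_smul, Complex.smul_re, smul_eq_mul, inv_mul_le_iff₀ hρK]

theorem filterable_or_exists_isDualFeasible {ρ : Matrix (A × B) (A × B) ℂ} (hρ : ρ.PosSemidef)
    {lam lam' : ℝ} (hlam : 0 < lam) (hlam' : lam < lam') (c : ℝ) :
    Filterable ρ c lam' ∨ ∃ M q, IsDualFeasible lam M q ∧ 0 < q ∧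
      expectation ρ ((M + q • 1)⁻¹ * (M + q • 1)⁻¹) ≤ expectation ρ (M + q • 1)⁻¹ ∧
      expectation ρ (M + q • 1)⁻¹ < c := by
  have hlam'₀ : 0 < lam' := hlam.trans hlam'
  -- Relaxing `lam` to `lam'` leaves room for `1 - lam / lam' ≤ q`, which makes `M + q` invertible.
  have hη₀ : 0 < 1 - lam / lam' := sub_pos.2 ((div_lt_one hlam'₀).2 hlam')
  have hη₁ : 1 - lam / lam' ≤ 1 := sub_le_self _ (div_pos hlam hlam'₀).le
  obtain ⟨M, q, hMq, hηq, hopt⟩ :=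
    exists_isDualFeasible_forall_expectation_le ρ hlam hη₀ hη₁
  have hK := posDef_add_smul_one hMq.posSemidef (hη₀.trans_le hηq)
  set K := M + q • 1
  have htrace : expectation ρ (K⁻¹ * K⁻¹) ≤ expectation ρ K⁻¹ := by
    have := hopt 0 1 (isDualFeasible_zero_one lam) hη₁
    rwa [zero_add, one_smul, expectation_conj, Matrix.mul_one] at this
  rcases lt_or_ge (expectation ρ K⁻¹) c with hlt | hge
  · exact .inr ⟨M, q, hMq, hη₀.trans_le hηq, htrace, hlt⟩
  refine .inl ?_
  rcases le_or_gt c 0 with hc | hc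
  · exact filterable_of_nonpos ρ hc hlam'₀.le
  have hf := hc.trans_le hge
  have hτ := conj_posSemidef hρ hK.inv.1
  refine (filterable_of_hasGuessingBound_conj_inv hK hf htrace
    (hasGuessingBound_of_forall_dual hτ.1 (mul_pos hf hlam'₀) fun M' hM' hM'₁ ↦ ?_)).mono hge
  have feasible : IsDualFeasible lam (lam'⁻¹ • M') (1 - lam / lam') := by
    refine ⟨posSemidef_real_smul hM' (by positivity), hη₀.le, hη₁, ?_⟩
    have := posSemidef_real_smul hM'₁ (div_pos hlam hlam'₀).le
    rwa [sub_sub_cancel, map_smul, smul_smul, ← div_eq_mul_inv, ← smul_sub]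
  have := (expectation_mono (X := lam'⁻¹ • M') hτ ?_).trans (hopt _ _ feasible le_rfl)
  · rwa [map_smul, smul_eq_mul, inv_mul_le_iff₀ hlam'₀, mul_comm] at this
  · rw [add_sub_cancel_left]
    exact posSemidef_real_smul PosSemidef.one hη₀.le

theorem IsDualFeasible.expectation_le_one {lam q : ℝ} {M τ : Matrix (A × B) (A × B) ℂ}
    (h : IsDualFeasible lam M q) (hlam : 0 < lam) (htr : τ.trace.re ≤ 1)
    (hτ : HasGuessingBound τ lam) : expectation τ (M + q • 1) ≤ 1 := by
  obtain ⟨σ, hσ, hστ, hσ_tr⟩ := hτ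
  have guessing : expectation τ M ≤ expectation σ (partialTrace M) := by
    rw [← expectation_one_kronecker, expectation_comm, expectation_comm _ M]
    exact expectation_mono h.posSemidef hστ
  have slack := expectation_mono hσ h.partialTrace_le
  rw [map_smul, map_smul, expectation_one, smul_eq_mul, smul_eq_mul] at slack
  have : expectation σ (partialTrace M) ≤ 1 - q := by
    refine le_of_mul_le_mul_left (slack.trans ?_) hlam
    rw [mul_comm]
    exact mul_le_mul_of_nonneg_right hσ_tr (sub_nonneg.2 h.le_one)
  rw [map_add, map_smul, expectation_one, smul_eq_mul]
  linarith [mul_le_of_le_one_right h.nonneg htr]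

theorem IsDualFeasible.fidelity_sq_le_expectation_inv {lam q : ℝ} {M ρ τ : Matrix (A × B) (A × B) ℂ}
    (h : IsDualFeasible lam M q) (hlam : 0 < lam) (hq : 0 < q) (hρ : ρ.PosSemidef)
    (hτ : τ.PosSemidef) (htr : τ.trace.re ≤ 1) (hbound : HasGuessingBound τ lam) :
    fidelity ρ τ ^ 2 ≤ expectation ρ (M + q • 1)⁻¹ := by
  have hK := posDef_add_smul_one h.posSemidef hq
  exact (fidelity_sq_le hρ hτ hK).trans (mul_le_of_le_one_right
    (expectation_nonneg hρ hK.inv.posSemidef) (h.expectation_le_one hlam htr hbound))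

end Dichotomy

section Kronecker

variable {C D : Type*}

theorem sub_kronecker_sub (X₀ Y₀ : Matrix C C ℂ) (X₁ Y₁ : Matrix D D ℂ) :
    (X₀ - Y₀) ⊗ₖ (X₁ - Y₁) = X₀ ⊗ₖ X₁ - X₀ ⊗ₖ Y₁ - Y₀ ⊗ₖ X₁ + Y₀ ⊗ₖ Y₁ := by
  ext ⟨i, k⟩ ⟨j, l⟩
  simp only [kronecker_apply, Matrix.sub_apply, Matrix.add_apply]
  ring

theorem isHermitian_kronecker {X₀ : Matrix C C ℂ} {X₁ : Matrix D D ℂ} (h₀ : X₀.IsHermitian)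
    (h₁ : X₁.IsHermitian) : (X₀ ⊗ₖ X₁).IsHermitian := by
  rw [IsHermitian, conjTranspose_kronecker, h₀.eq, h₁.eq]

theorem expectation_kronecker [Fintype C] [Fintype D] {ρ₀ X₀ : Matrix C C ℂ}
    (hρ₀ : ρ₀.IsHermitian) (hX₀ : X₀.IsHermitian) (ρ₁ X₁ : Matrix D D ℂ) :
    expectation (ρ₀ ⊗ₖ ρ₁) (X₀ ⊗ₖ X₁) = expectation ρ₀ X₀ * expectation ρ₁ X₁ := by
  have trace_real : (ρ₀ * X₀).trace.im = 0 := by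
    rw [← Complex.conj_eq_iff_im, ← Complex.star_def, ← trace_conjTranspose, conjTranspose_mul,
      hρ₀.eq, hX₀.eq, trace_mul_comm]
  rw [expectation_apply, ← mul_kronecker_mul, trace_kronecker, Complex.mul_re, trace_real,
    zero_mul, sub_zero, expectation_apply, expectation_apply]

theorem kronecker_le_smul_one [Finite C] [Finite D] [DecidableEq C] [DecidableEq D]
    {N₀ : Matrix C C ℂ} {N₁ : Matrix D D ℂ} (hN₁ : N₁.PosSemidef) {p₀ p₁ : ℝ}
    (hp₀ : 0 ≤ p₀) (h₀ : (p₀ • 1 - N₀).PosSemidef) (h₁ : (p₁ • 1 - N₁).PosSemidef) :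
    ((p₀ * p₁) • (1 : Matrix (C × D) (C × D) ℂ) - N₀ ⊗ₖ N₁).PosSemidef := by
  have telescope : (p₀ * p₁) • (1 : Matrix (C × D) (C × D) ℂ) - N₀ ⊗ₖ N₁
      = (p₀ • 1) ⊗ₖ (p₁ • 1 - N₁) + (p₀ • 1 - N₀) ⊗ₖ N₁ := by
    rw [← one_kronecker_one]
    ext ⟨i, k⟩ ⟨j, l⟩
    simp only [kronecker_apply, Matrix.sub_apply, Matrix.add_apply, Matrix.smul_apply,
      Complex.real_smul]
    push_cast
    ring
  rw [telescope]
  exact ((posSemidef_real_smul PosSemidef.one hp₀).kronecker h₁).add (h₀.kronecker hN₁)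

end Kronecker

section ProductCertificate

variable {n C D : Type*} [Fintype n] [Fintype C] [Fintype D]
  [DecidableEq n] [DecidableEq C] [DecidableEq D]

theorem mul_inv_add_smul_one {M : Matrix n n ℂ} (hM : M.PosSemidef) {q : ℝ} (hq : 0 < q) :
    M * (M + q • 1)⁻¹ = 1 - q • (M + q • 1)⁻¹ := by
  have h := mul_nonsing_inv _ (isUnit_det (posDef_add_smul_one hM hq))
  rw [Matrix.add_mul, Matrix.smul_mul, Matrix.one_mul] at h
  exact eq_sub_of_add_eq h

theorem smul_one_sub_inv_posSemidef {M : Matrix n n ℂ} (hM : M.PosSemidef) {q : ℝ} (hq : 0 < q) :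
    (q⁻¹ • 1 - (M + q • 1)⁻¹).PosSemidef := by
  have hK := posDef_add_smul_one hM hq
  have hMK := mul_inv_add_smul_one hM hq
  have hKM : (M + q • 1) * M = M * Mᴴ + q • M := by
    rw [Matrix.add_mul, Matrix.smul_mul, Matrix.one_mul, hM.1.eq]
  set K := M + q • 1
  have eq : q⁻¹ • 1 - K⁻¹ = q⁻¹ • (K⁻¹ * (M * Mᴴ + q • M) * K⁻¹) := by
    rw [← hKM, nonsing_inv_mul_cancel_left _ _ (isUnit_det hK), hMK, smul_sub,
      inv_smul_smul₀ hq.ne']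
  rw [eq]
  exact posSemidef_real_smul (conj_posSemidef
    ((posSemidef_self_mul_conjTranspose M).add (posSemidef_real_smul hM hq.le)) hK.inv.1)
    (inv_nonneg.2 hq.le)

/-- Newton's iteration for `K⁻¹` started at `W`, with the remainder bounded by `K⁻¹ ≤ q⁻¹`. -/
theorem inv_le_of_residual {M W δ : Matrix n n ℂ} (hM : M.PosSemidef) (hW : W.IsHermitian) {q : ℝ}
    (hq : 0 < q) (hδ : 1 - (M + q • 1) * W = δ) :
    (W + W * δ + q⁻¹ • (δᴴ * δ) - (M + q • 1)⁻¹).PosSemidef := by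
  have hK := posDef_add_smul_one hM hq
  have hinv := smul_one_sub_inv_posSemidef hM hq
  set K := M + q • 1
  have left : δᴴ * K⁻¹ = K⁻¹ - W := by
    rw [← hδ, conjTranspose_sub, conjTranspose_one, conjTranspose_mul, hW.eq, hK.1.eq,
      Matrix.sub_mul, Matrix.one_mul, mul_nonsing_inv_cancel_right _ _ (isUnit_det hK)]
  have right : K⁻¹ * δ = K⁻¹ - W := by
    rw [← hδ, Matrix.mul_sub, Matrix.mul_one, nonsing_inv_mul_cancel_left _ _ (isUnit_det hK)]
  have remainder : W + W * δ + q⁻¹ • (δᴴ * δ) - K⁻¹ = δᴴ * (q⁻¹ • 1 - K⁻¹) * δ := by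
    rw [Matrix.mul_sub, Matrix.sub_mul, left, Matrix.sub_mul, right, Matrix.mul_smul,
      Matrix.mul_one, Matrix.smul_mul]
    abel
  rw [remainder]
  exact hinv.conjTranspose_mul_mul_same δ

theorem inv_kronecker_add_smul_one_le {M₀ y₀ : Matrix C C ℂ} {M₁ y₁ : Matrix D D ℂ}
    (hM₀ : M₀.PosSemidef) (hM₁ : M₁.PosSemidef) (hy₀ : y₀.IsHermitian) (hy₁ : y₁.IsHermitian)
    {q₀ q₁ : ℝ} (h₀ : M₀ * y₀ = 1 - q₀ • y₀) (h₁ : M₁ * y₁ = 1 - q₁ • y₁)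
    (hq : 0 < q₀ + q₁ - q₀ * q₁) :
    (y₀ ⊗ₖ y₁ + (q₀ • ((y₀ * y₀) ⊗ₖ (y₁ * (1 - y₁))) + q₁ • ((y₀ * (1 - y₀)) ⊗ₖ (y₁ * y₁)))
      + (q₀ + q₁ - q₀ * q₁)⁻¹ • (q₀ ^ 2 • ((y₀ * y₀) ⊗ₖ ((1 - y₁) * (1 - y₁)))
        + q₁ ^ 2 • (((1 - y₀) * (1 - y₀)) ⊗ₖ (y₁ * y₁))
        + (2 * (q₀ * q₁)) • ((y₀ * (1 - y₀)) ⊗ₖ (y₁ * (1 - y₁))))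
      - (M₀ ⊗ₖ M₁ + (q₀ + q₁ - q₀ * q₁) • 1)⁻¹).PosSemidef := by
  set δ := q₀ • (y₀ ⊗ₖ (1 - y₁)) + q₁ • ((1 - y₀) ⊗ₖ y₁)
  have residual : 1 - (M₀ ⊗ₖ M₁ + (q₀ + q₁ - q₀ * q₁) • 1) * (y₀ ⊗ₖ y₁) = δ := by
    have expand₀ : (1 - y₀) ⊗ₖ y₁ = 1 ⊗ₖ y₁ - y₀ ⊗ₖ y₁ := by
      simpa using sub_kronecker_sub 1 y₀ y₁ 0
    have expand₁ : y₀ ⊗ₖ (1 - y₁) = y₀ ⊗ₖ 1 - y₀ ⊗ₖ y₁ := by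
      simpa using sub_kronecker_sub y₀ 0 1 y₁
    rw [Matrix.add_mul, ← mul_kronecker_mul, h₀, h₁, sub_kronecker_sub, Matrix.smul_mul,
      Matrix.one_mul, one_kronecker_one]
    simp only [δ, expand₀, expand₁, kronecker_smul, smul_kronecker]
    module
  have h := inv_le_of_residual (hM₀.kronecker hM₁) (isHermitian_kronecker hy₀ hy₁) hq residual
  have δ_adjoint : δᴴ = δ := by
    simp only [δ, conjTranspose_add, conjTranspose_smul, conjTranspose_kronecker,
      conjTranspose_sub, conjTranspose_one, hy₀.eq, hy₁.eq, star_trivial]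
  have comm₀ : (1 - y₀) * y₀ = y₀ * (1 - y₀) := by
    rw [Matrix.mul_sub, Matrix.sub_mul, Matrix.mul_one, Matrix.one_mul]
  have comm₁ : (1 - y₁) * y₁ = y₁ * (1 - y₁) := by
    rw [Matrix.mul_sub, Matrix.sub_mul, Matrix.mul_one, Matrix.one_mul]
  convert! h using 4
  · simp only [δ, Matrix.mul_add, Matrix.mul_smul, ← mul_kronecker_mul]
  · rw [δ_adjoint]
    simp only [δ, Matrix.mul_add, Matrix.add_mul, Matrix.mul_smul, Matrix.smul_mul,
      ← mul_kronecker_mul, comm₀, comm₁]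
    module

theorem residual_moments_le {q₀ q₁ b₀ e₀ d₀ b₁ e₁ d₁ : ℝ} (hq₀ : 0 < q₀) (hq₁ : 0 < q₁)
    (hq₀' : q₀ ≤ 1) (hq₁' : q₁ ≤ 1) (hb₀ : 0 ≤ b₀) (he₀ : 0 ≤ e₀) (hd₀ : 0 ≤ d₀) (hb₁ : 0 ≤ b₁)
    (he₁ : 0 ≤ e₁) (hd₁ : 0 ≤ d₁) :
    q₀ * (b₀ * e₁) + q₁ * (e₀ * b₁) + (q₀ + q₁ - q₀ * q₁)⁻¹ *
        (q₀ ^ 2 * (b₀ * d₁) + q₁ ^ 2 * (d₀ * b₁) + 2 * (q₀ * q₁) * (e₀ * e₁))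
      ≤ (b₀ + e₀) * (e₁ + d₁) + (e₀ + d₀) * (b₁ + e₁) := by
  have hq₀_le : q₀ ≤ q₀ + q₁ - q₀ * q₁ := by nlinarith
  have hq₁_le : q₁ ≤ q₀ + q₁ - q₀ * q₁ := by nlinarith
  set q := q₀ + q₁ - q₀ * q₁
  have first_order : q₀ * (b₀ * e₁) + q₁ * (e₀ * b₁) ≤ b₀ * e₁ + e₀ * b₁ :=
    add_le_add (mul_le_of_le_one_left (mul_nonneg hb₀ he₁) hq₀')
      (mul_le_of_le_one_left (mul_nonneg he₀ hb₁) hq₁')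
  have second_order : q⁻¹ * (q₀ ^ 2 * (b₀ * d₁) + q₁ ^ 2 * (d₀ * b₁) + 2 * (q₀ * q₁) * (e₀ * e₁))
      ≤ b₀ * d₁ + d₀ * b₁ + 2 * (e₀ * e₁) := by
    rw [inv_mul_le_iff₀ (hq₀.trans_le hq₀_le)]
    have h₀ : q₀ ^ 2 ≤ q := by nlinarith
    have h₁ : q₁ ^ 2 ≤ q := by nlinarith
    have h₀₁ : q₀ * q₁ ≤ q := by nlinarith
    linarith [mul_le_mul_of_nonneg_right h₀ (mul_nonneg hb₀ hd₁),
      mul_le_mul_of_nonneg_right h₁ (mul_nonneg hd₀ hb₁),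
      mul_le_mul_of_nonneg_right h₀₁ (mul_nonneg he₀ he₁)]
  nlinarith [mul_nonneg he₀ hd₁, mul_nonneg hd₀ he₁]

theorem expectation_mul_self_add_mul_one_sub (ρ y : Matrix n n ℂ) :
    expectation ρ (y * y) + expectation ρ (y * (1 - y)) = expectation ρ y := by
  rw [← map_add, ← Matrix.mul_add, add_sub_cancel, Matrix.mul_one]

theorem expectation_mul_one_sub_add_mul_self {ρ : Matrix n n ℂ} (hρ : IsState ρ)
    (y : Matrix n n ℂ) :
    expectation ρ (y * (1 - y)) + expectation ρ ((1 - y) * (1 - y)) = 1 - expectation ρ y := by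
  rw [← map_add, ← Matrix.add_mul, add_sub_cancel, Matrix.one_mul, map_sub, expectation_one, hρ.2,
    Complex.one_re]

theorem expectation_kronecker_inv_le {ρ₀ M₀ : Matrix C C ℂ} {ρ₁ M₁ : Matrix D D ℂ}
    (hρ₀ : IsState ρ₀) (hρ₁ : IsState ρ₁) (hM₀ : M₀.PosSemidef) (hM₁ : M₁.PosSemidef)
    {q₀ q₁ : ℝ} (hq₀ : 0 < q₀) (hq₁ : 0 < q₁) (hq₀' : q₀ ≤ 1) (hq₁' : q₁ ≤ 1)
    (h₀ : expectation ρ₀ ((M₀ + q₀ • 1)⁻¹ * (M₀ + q₀ • 1)⁻¹) ≤ expectation ρ₀ (M₀ + q₀ • 1)⁻¹)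
    (h₁ : expectation ρ₁ ((M₁ + q₁ • 1)⁻¹ * (M₁ + q₁ • 1)⁻¹) ≤ expectation ρ₁ (M₁ + q₁ • 1)⁻¹) :
    expectation (ρ₀ ⊗ₖ ρ₁) (M₀ ⊗ₖ M₁ + (q₀ + q₁ - q₀ * q₁) • 1)⁻¹ ≤
      1 - (1 - expectation ρ₀ (M₀ + q₀ • 1)⁻¹) * (1 - expectation ρ₁ (M₁ + q₁ • 1)⁻¹) := by
  have hy₀ := (posDef_add_smul_one hM₀ hq₀).inv.1
  have hy₁ := (posDef_add_smul_one hM₁ hq₁).inv.1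
  have operator_bound := inv_kronecker_add_smul_one_le hM₀ hM₁ hy₀ hy₁
    (mul_inv_add_smul_one hM₀ hq₀) (mul_inv_add_smul_one hM₁ hq₁) (by nlinarith)
  set y₀ := (M₀ + q₀ • 1)⁻¹
  set y₁ := (M₁ + q₁ • 1)⁻¹
  have hz₀ : (1 - y₀).IsHermitian := isHermitian_one.sub hy₀
  have hz₁ : (1 - y₁).IsHermitian := isHermitian_one.sub hy₁
  have hyz₀ : (y₀ * (1 - y₀)).IsHermitian := by
    rw [Matrix.mul_sub, Matrix.mul_one]
    exact hy₀.sub (mul_self_posSemidef hy₀).1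
  have moments := residual_moments_le hq₀ hq₁ hq₀' hq₁'
    (expectation_nonneg hρ₀.1 (mul_self_posSemidef hy₀))
    (he₀ := sub_nonneg.2 h₀)
    (expectation_nonneg hρ₀.1 (mul_self_posSemidef hz₀))
    (expectation_nonneg hρ₁.1 (mul_self_posSemidef hy₁))
    (he₁ := sub_nonneg.2 h₁)
    (expectation_nonneg hρ₁.1 (mul_self_posSemidef hz₁))
  have bound := expectation_mono (hρ₀.1.kronecker hρ₁.1) operator_bound
  simp only [map_add, map_smul, smul_eq_mul, expectation_kronecker hρ₀.1.1 hy₀,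
    expectation_kronecker hρ₀.1.1 (mul_self_posSemidef hy₀).1,
    expectation_kronecker hρ₀.1.1 (mul_self_posSemidef hz₀).1,
    expectation_kronecker hρ₀.1.1 hyz₀] at bound
  have add₀ := expectation_mul_self_add_mul_one_sub ρ₀ y₀
  have add₁ := expectation_mul_self_add_mul_one_sub ρ₁ y₁
  have add₀' := expectation_mul_one_sub_add_mul_self hρ₀ y₀
  have add₁' := expectation_mul_one_sub_add_mul_self hρ₁ y₁
  rw [← add₀, add_sub_cancel_left, ← add₁, add_sub_cancel_left, add₀, add₁, add₀', add₁'] at moments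
  linarith

end ProductCertificate

section IndependentStates

variable {A₀ A₁ B₀ B₁ : Type*}

theorem indepState_posSemidef [Finite A₀] [Finite A₁] [Finite B₀] [Finite B₁]
    {ρ₀ : Matrix (A₀ × B₀) (A₀ × B₀) ℂ} {ρ₁ : Matrix (A₁ × B₁) (A₁ × B₁) ℂ}
    (h₀ : ρ₀.PosSemidef) (h₁ : ρ₁.PosSemidef) :
    (indepState ρ₀ ρ₁).PosSemidef :=
  (h₀.kronecker h₁).submatrix _

variable [Fintype A₀] [Fintype A₁]

theorem partialTrace_indepState (M₀ : Matrix (A₀ × B₀) (A₀ × B₀) ℂ)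
    (M₁ : Matrix (A₁ × B₁) (A₁ × B₁) ℂ) :
    partialTrace (indepState M₀ M₁) = partialTrace M₀ ⊗ₖ partialTrace M₁ := by
  ext ⟨b₀, b₁⟩ ⟨c₀, c₁⟩
  simp only [partialTrace_apply, kronecker_apply, Fintype.sum_prod_type, Matrix.sum_apply,
    Finset.sum_mul_sum]
  rfl

theorem isDualFeasible_indepState [Finite B₀] [Finite B₁] [DecidableEq B₀] [DecidableEq B₁]
    {lam₀ lam₁ q₀ q₁ : ℝ} {M₀ : Matrix (A₀ × B₀) (A₀ × B₀) ℂ}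
    {M₁ : Matrix (A₁ × B₁) (A₁ × B₁) ℂ} (h₀ : IsDualFeasible lam₀ M₀ q₀)
    (h₁ : IsDualFeasible lam₁ M₁ q₁) (hlam₁ : 0 ≤ lam₁) :
    IsDualFeasible (lam₀ * lam₁) (indepState M₀ M₁) (q₀ + q₁ - q₀ * q₁) where
  posSemidef := indepState_posSemidef h₀.posSemidef h₁.posSemidef
  nonneg := by nlinarith [h₀.nonneg, h₀.le_one, h₁.nonneg]
  le_one := by nlinarith [h₀.le_one, h₁.le_one]
  partialTrace_le := by
    have h := kronecker_le_smul_one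
      (posSemidef_real_smul (partialTrace_posSemidef h₁.posSemidef) hlam₁)
      (sub_nonneg.2 h₀.le_one) h₀.partialTrace_le h₁.partialTrace_le
    rwa [smul_kronecker, kronecker_smul, smul_smul, ← partialTrace_indepState,
      show (1 - q₀) * (1 - q₁) = 1 - (q₀ + q₁ - q₀ * q₁) by ring] at h

variable [Fintype B₀] [Fintype B₁]
  [DecidableEq A₀] [DecidableEq A₁] [DecidableEq B₀] [DecidableEq B₁]

theorem expectation_indepState_inv (ρ₀ M₀ : Matrix (A₀ × B₀) (A₀ × B₀) ℂ)
    (ρ₁ M₁ : Matrix (A₁ × B₁) (A₁ × B₁) ℂ) (q : ℝ) :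
    expectation (indepState ρ₀ ρ₁) (indepState M₀ M₁ + q • 1)⁻¹ =
      expectation (ρ₀ ⊗ₖ ρ₁) (M₀ ⊗ₖ M₁ + q • 1)⁻¹ := by
  set e := (Equiv.prodProdProdComm A₀ B₀ A₁ B₁).symm
  have shift : indepState M₀ M₁ + q • 1 = (M₀ ⊗ₖ M₁ + q • 1).submatrix e e := by
    rw [submatrix_add, submatrix_smul]
    simp only [Pi.add_apply, Pi.smul_apply, submatrix_one_equiv]
    rfl
  rw [shift, inv_submatrix_equiv]
  exact expectation_submatrix_equiv _ _ e

theorem fidelity_sq_indepState_le {lam₀ lam₁ q₀ q₁ : ℝ} {ρ₀ M₀ : Matrix (A₀ × B₀) (A₀ × B₀) ℂ}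
    {ρ₁ M₁ : Matrix (A₁ × B₁) (A₁ × B₁) ℂ} (hρ₀ : IsState ρ₀) (hρ₁ : IsState ρ₁)
    (hM₀ : IsDualFeasible lam₀ M₀ q₀) (hM₁ : IsDualFeasible lam₁ M₁ q₁) (hlam₀ : 0 < lam₀)
    (hlam₁ : 0 < lam₁) (hq₀ : 0 < q₀) (hq₁ : 0 < q₁)
    (h₀ : expectation ρ₀ ((M₀ + q₀ • 1)⁻¹ * (M₀ + q₀ • 1)⁻¹) ≤ expectation ρ₀ (M₀ + q₀ • 1)⁻¹)
    (h₁ : expectation ρ₁ ((M₁ + q₁ • 1)⁻¹ * (M₁ + q₁ • 1)⁻¹) ≤ expectation ρ₁ (M₁ + q₁ • 1)⁻¹)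
    {τ : Matrix ((A₀ × A₁) × (B₀ × B₁)) ((A₀ × A₁) × (B₀ × B₁)) ℂ} (hτ : τ.PosSemidef)
    (htr : τ.trace.re ≤ 1) (hbound : HasGuessingBound τ (lam₀ * lam₁)) :
    fidelity (indepState ρ₀ ρ₁) τ ^ 2 ≤
      1 - (1 - expectation ρ₀ (M₀ + q₀ • 1)⁻¹) * (1 - expectation ρ₁ (M₁ + q₁ • 1)⁻¹) := by
  have hq : 0 < q₀ + q₁ - q₀ * q₁ := by nlinarith [hM₀.le_one]
  refine ((isDualFeasible_indepState hM₀ hM₁ hlam₁.le).fidelity_sq_le_expectation_inv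
    (mul_pos hlam₀ hlam₁) hq (indepState_posSemidef hρ₀.1 hρ₁.1) hτ htr hbound).trans ?_
  rw [expectation_indepState_inv]
  exact expectation_kronecker_inv_le hρ₀ hρ₁ hM₀.posSemidef hM₁.posSemidef hq₀ hq₁ hM₀.le_one
    hM₁.le_one h₀ h₁

end IndependentStates

section AdjoinSystem

variable {A B F R : Type*}

/-- The operator `ρ_AB ⊗ τ_R`, with `k` identifying the right system `F` with `B × R`. -/
def adjoinSystem (k : F ≃ B × R) (ρ : Matrix (A × B) (A × B) ℂ) (τ : Matrix R R ℂ) :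
    Matrix (A × F) (A × F) ℂ :=
  (ρ ⊗ₖ τ).submatrix (((Equiv.refl A).prodCongr k).trans (Equiv.prodAssoc A B R).symm)
    (((Equiv.refl A).prodCongr k).trans (Equiv.prodAssoc A B R).symm)

theorem adjoinSystem_sub (k : F ≃ B × R) (X Y : Matrix (A × B) (A × B) ℂ) (τ : Matrix R R ℂ) :
    adjoinSystem k (X - Y) τ = adjoinSystem k X τ - adjoinSystem k Y τ := by
  ext p p'
  exact sub_mul _ _ _

theorem adjoinSystem_posSemidef [Finite A] [Finite B] [Finite R] (k : F ≃ B × R)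
    {ρ : Matrix (A × B) (A × B) ℂ} {τ : Matrix R R ℂ} (hρ : ρ.PosSemidef) (hτ : τ.PosSemidef) :
    (adjoinSystem k ρ τ).PosSemidef :=
  (hρ.kronecker hτ).submatrix _

variable [Fintype B] [Fintype R] [Fintype F]

theorem hasGuessingBound_adjoinSystem [Finite A] [DecidableEq A] (k : F ≃ B × R)
    {ρ : Matrix (A × B) (A × B) ℂ} {lam : ℝ} (h : HasGuessingBound ρ lam)
    {τ : Matrix R R ℂ} (hτ : IsState τ) : HasGuessingBound (adjoinSystem k ρ τ) lam := by
  obtain ⟨σ, hσ, hσρ, hlam⟩ := h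
  refine ⟨(σ ⊗ₖ τ).submatrix k k, (hσ.kronecker hτ.1).submatrix _, ?_, ?_⟩
  · convert! adjoinSystem_posSemidef k hσρ hτ.1 using 1
    rw [adjoinSystem_sub]
    congr 1
    ext p p'
    exact (mul_assoc _ _ _).symm
  · rwa [trace_submatrix_equiv, trace_kronecker, hτ.2, mul_one]

variable [Fintype A]

theorem adjoinSystem_mul (k : F ≃ B × R) (X Y : Matrix (A × B) (A × B) ℂ) (S T : Matrix R R ℂ) :
    adjoinSystem k X S * adjoinSystem k Y T = adjoinSystem k (X * Y) (S * T) := by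
  rw [adjoinSystem, adjoinSystem, submatrix_mul_equiv, ← mul_kronecker_mul, adjoinSystem]

theorem expectation_adjoinSystem [DecidableEq R] (k : F ≃ B × R)
    {ρ X : Matrix (A × B) (A × B) ℂ} {τ : Matrix R R ℂ} (hρ : ρ.IsHermitian)
    (hX : X.IsHermitian) (hτ : IsState τ) :
    expectation (adjoinSystem k ρ τ) (adjoinSystem k X 1) = expectation ρ X := by
  rw [adjoinSystem, adjoinSystem, expectation_submatrix_equiv, expectation_kronecker hρ hX,
    expectation_one, hτ.2, Complex.one_re, mul_one]

theorem filterable_adjoinSystem [DecidableEq A] (k : F ≃ B × R)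
    {ρ : Matrix (A × B) (A × B) ℂ} (hρ : ρ.PosSemidef) {c lam : ℝ} (h : Filterable ρ c lam)
    {τ : Matrix R R ℂ} (hτ : IsState τ) : Filterable (adjoinSystem k ρ τ) c lam := by
  classical
  obtain ⟨Z, hZ, hc, htr, hbound⟩ := h
  refine ⟨adjoinSystem k Z 1, adjoinSystem_posSemidef k hZ PosSemidef.one, ?_, ?_, ?_⟩
  · rwa [expectation_adjoinSystem k hρ.1 hZ.1 hτ]
  · rwa [adjoinSystem_mul, Matrix.one_mul,
      expectation_adjoinSystem k hρ.1 (mul_self_posSemidef hZ.1).1 hτ]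
  · rw [adjoinSystem_mul, adjoinSystem_mul, Matrix.one_mul, Matrix.mul_one]
    exact hasGuessingBound_adjoinSystem k hbound hτ

end AdjoinSystem

section ClassicalRegister

variable {X Y E : Type*} [DecidableEq X]

/-- The operator `∑ₓ |x⟩⟨x| ⊗ βₓ`, classical on the register `X`. The blocks are not normalized:
for a cq-state `βₓ = P_X(x) ρ_E^x`. -/
def cqOperator (β : X → Matrix E E ℂ) : Matrix (X × E) (X × E) ℂ :=
  (blockDiagonal β).submatrix (Equiv.prodComm X E) (Equiv.prodComm X E)

theorem cqOperator_sub (β γ : X → Matrix E E ℂ) :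
    cqOperator (β - γ) = cqOperator β - cqOperator γ := by
  rw [cqOperator, blockDiagonal_sub, submatrix_sub]
  rfl

theorem diagBlock_cqOperator (β : X → Matrix E E ℂ) : diagBlock (cqOperator β) = β := by
  ext x e e'
  exact if_pos rfl

theorem one_kronecker_eq_cqOperator (σ : Matrix E E ℂ) :
    (1 : Matrix X X ℂ) ⊗ₖ σ = cqOperator fun _ ↦ σ :=
  one_kronecker σ

theorem sum_single_kronecker [Fintype Y] (f : Y → X) (γ : Y → Matrix E E ℂ) :
    ∑ y, single (f y) (f y) (1 : ℂ) ⊗ₖ γ y = cqOperator fun x ↦ ∑ y with f y = x, γ y := by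
  ext ⟨x, e⟩ ⟨x', e'⟩
  simp only [cqOperator, Matrix.sum_apply, kronecker_apply, single_apply, submatrix_apply,
    blockDiagonal_apply, Equiv.prodComm_apply, Prod.swap]
  rcases eq_or_ne x x' with rfl | hx
  · simp [Finset.sum_filter]
  · rw [if_neg hx]
    exact Finset.sum_eq_zero fun y _ ↦ by grind

theorem cqOperator_eq_sum [Fintype X] (β : X → Matrix E E ℂ) :
    cqOperator β = ∑ x, single x x (1 : ℂ) ⊗ₖ β x := by
  rw [sum_single_kronecker fun x ↦ x]
  simp [Finset.filter_eq']

theorem cqOperator_posSemidef [Finite X] [Finite E] {β : X → Matrix E E ℂ}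
    (hβ : ∀ x, (β x).PosSemidef) : (cqOperator β).PosSemidef := by
  cases nonempty_fintype X
  rw [cqOperator_eq_sum]
  refine posSemidef_sum _ fun x _ ↦ PosSemidef.kronecker ?_ (hβ x)
  rw [← diagonal_single]
  refine PosSemidef.diagonal ?_
  simp

variable [Fintype X] [Fintype E]

theorem diagBlock_cqOperator_mul (β : X → Matrix E E ℂ) (Z : Matrix (X × E) (X × E) ℂ) (x : X) :
    diagBlock (cqOperator β * Z) x = β x * diagBlock Z x := by
  ext e e'
  simp [diagBlock, cqOperator, mul_apply, Fintype.sum_prod_type, blockDiagonal_apply]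

theorem expectation_cqOperator (β : X → Matrix E E ℂ) (Z : Matrix (X × E) (X × E) ℂ) :
    expectation (cqOperator β) Z = ∑ x, expectation (β x) (diagBlock Z x) := by
  rw [expectation_apply, ← trace_partialTrace, partialTrace_apply, trace_sum, Complex.re_sum]
  simp only [diagBlock_cqOperator_mul, expectation_apply]

theorem cqOperator_mul (β γ : X → Matrix E E ℂ) :
    cqOperator β * cqOperator γ = cqOperator fun x ↦ β x * γ x := by
  rw [cqOperator, cqOperator, submatrix_mul_equiv, ← blockDiagonal_mul, cqOperator]

theorem diagBlock_mul_cqOperator_single_mul (Z : Matrix (X × E) (X × E) ℂ) (x : X)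
    (b : Matrix E E ℂ) :
    diagBlock (Z * cqOperator (Pi.single x b) * Z) x = diagBlock Z x * b * diagBlock Z x := by
  ext e e'
  simp only [diagBlock, cqOperator, submatrix_apply, mul_apply, Fintype.sum_prod_type,
    blockDiagonal_apply, Equiv.prodComm_apply, Prod.swap, mul_ite, mul_zero, Finset.sum_ite_irrel,
    Finset.sum_const_zero, Finset.sum_ite_eq', Finset.mem_univ, if_true]
  rw [Fintype.sum_eq_single x fun y hy ↦ by simp [hy], Pi.single_eq_same]

theorem diagBlock_conj_cqOperator_sub_posSemidef {Z : Matrix (X × E) (X × E) ℂ}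
    (hZ : Z.IsHermitian) {β : X → Matrix E E ℂ} (hβ : ∀ x, (β x).PosSemidef) (x : X) :
    (diagBlock (Z * cqOperator β * Z) x - diagBlock Z x * β x * diagBlock Z x).PosSemidef := by
  have rest : (cqOperator (β - Pi.single x (β x))).PosSemidef := by
    refine cqOperator_posSemidef fun y ↦ ?_
    rcases eq_or_ne y x with rfl | hy
    · simpa using PosSemidef.zero
    · simpa [hy] using hβ y
  convert! diagBlock_posSemidef (conj_posSemidef rest hZ) x using 1
  rw [cqOperator_sub, Matrix.mul_sub, Matrix.sub_mul, ← diagBlock_mul_cqOperator_single_mul]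
  rfl

omit [DecidableEq X] in
theorem diagBlock_mul_self_sub_posSemidef {Z : Matrix (X × E) (X × E) ℂ} (hZ : Z.IsHermitian)
    (x : X) : (diagBlock (Z * Z) x - diagBlock Z x * diagBlock Z x).PosSemidef := by
  classical
  have h := diagBlock_conj_cqOperator_sub_posSemidef hZ (fun _ ↦ PosSemidef.one) x
  rwa [← one_kronecker_eq_cqOperator, one_kronecker_one, Matrix.mul_one, Matrix.mul_one] at h

/-- A filter for an operator classical on `X` may be pinched: its diagonal blocks already do the
job. -/
theorem filterable_cqOperator_iff {β : X → Matrix E E ℂ} (hβ : ∀ x, (β x).PosSemidef) {c lam : ℝ} :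
    Filterable (cqOperator β) c lam ↔ ∃ Z : X → Matrix E E ℂ, (∀ x, (Z x).PosSemidef) ∧
      c ≤ (∑ x, expectation (β x) (Z x)) ^ 2 ∧ ∑ x, expectation (β x) (Z x * Z x) ≤ 1 ∧
      ∃ σ : Matrix E E ℂ, σ.PosSemidef ∧ (∀ x, (σ - Z x * β x * Z x).PosSemidef) ∧
        σ.trace.re ≤ lam := by
  constructor
  · rintro ⟨Z, hZ, hc, htr, σ, hσ, hσZ, hlam⟩
    rw [expectation_cqOperator] at hc htr
    refine ⟨diagBlock Z, diagBlock_posSemidef hZ, hc, htr.trans' ?_, σ, hσ, fun x ↦ ?_, hlam⟩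
    · exact Finset.sum_le_sum fun x _ ↦
        expectation_mono (hβ x) (diagBlock_mul_self_sub_posSemidef hZ.1 x)
    · convert! (diagBlock_posSemidef hσZ x).add
        (diagBlock_conj_cqOperator_sub_posSemidef hZ.1 hβ x) using 1
      have diagBlock_one_kronecker : diagBlock ((1 : Matrix X X ℂ) ⊗ₖ σ) x = σ := by
        rw [one_kronecker_eq_cqOperator, diagBlock_cqOperator]
      conv_lhs => rw [← diagBlock_one_kronecker]
      exact (sub_add_sub_cancel _ _ _).symm
  · rintro ⟨Z, hZ, hc, htr, σ, hσ, hσZ, hlam⟩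
    refine ⟨cqOperator Z, cqOperator_posSemidef hZ, ?_, ?_, σ, hσ, ?_, hlam⟩
    · simpa only [expectation_cqOperator, diagBlock_cqOperator] using hc
    · simpa only [cqOperator_mul, expectation_cqOperator, diagBlock_cqOperator] using htr
    · rw [one_kronecker_eq_cqOperator, cqOperator_mul, cqOperator_mul, ← cqOperator_sub]
      exact cqOperator_posSemidef hσZ

end ClassicalRegister

section MapClassical

variable {X Y W E : Type*} [Fintype X] [DecidableEq Y]

theorem mapClassical_eq_cqOperator (f : X → Y) (ρ : Matrix (X × E) (X × E) ℂ) :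
    mapClassical f ρ = cqOperator fun y ↦ ∑ x with f x = y, diagBlock ρ x :=
  sum_single_kronecker f _

theorem mapClassical_posSemidef [Finite Y] [Finite E] (f : X → Y)
    {ρ : Matrix (X × E) (X × E) ℂ} (hρ : ρ.PosSemidef) : (mapClassical f ρ).PosSemidef := by
  rw [mapClassical_eq_cqOperator]
  exact cqOperator_posSemidef fun y ↦ posSemidef_sum _ fun x _ ↦ diagBlock_posSemidef hρ x

theorem mapClassical_mapClassical [Fintype Y] [DecidableEq W] (g : Y → W) (f : X → Y)
    (ρ : Matrix (X × E) (X × E) ℂ) :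
    mapClassical g (mapClassical f ρ) = mapClassical (g ∘ f) ρ := by
  simp only [mapClassical_eq_cqOperator, diagBlock_cqOperator]
  congr 1
  ext1 w
  rw [← Finset.sum_fiberwise_of_maps_to (t := {y | g y = w}) (g := f) (by simp)]
  refine Finset.sum_congr rfl fun y hy ↦ Finset.sum_congr ?_ fun _ _ ↦ rfl
  grind

theorem filterable_of_mapClassical [DecidableEq X] [Fintype Y] [Fintype E]
    {γ : X → Matrix E E ℂ} (hγ : ∀ x, (γ x).PosSemidef) (g : X → Y) {c lam : ℝ}
    (h : Filterable (mapClassical g (cqOperator γ)) c lam) : Filterable (cqOperator γ) c lam := by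
  simp only [mapClassical_eq_cqOperator, diagBlock_cqOperator] at h
  have fiber_posSemidef (s : Finset X) : (∑ x ∈ s, γ x).PosSemidef :=
    posSemidef_sum _ fun x _ ↦ hγ x
  have sum_fiberwise (W : Y → Matrix E E ℂ) :
      ∑ y, expectation (∑ x with g x = y, γ x) (W y) = ∑ x, expectation (γ x) (W (g x)) := by
    simp only [map_sum, LinearMap.sum_apply]
    rw [← Finset.sum_fiberwise _ g]
    refine Finset.sum_congr rfl fun y _ ↦ Finset.sum_congr rfl fun x hx ↦ ?_
    rw [(Finset.mem_filter.1 hx).2]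
  obtain ⟨Z, hZ, hc, htr, σ, hσ, hσZ, hlam⟩ :=
    (filterable_cqOperator_iff fun y ↦ fiber_posSemidef _).1 h
  rw [sum_fiberwise] at hc
  rw [sum_fiberwise fun y ↦ Z y * Z y] at htr
  refine (filterable_cqOperator_iff hγ).2
    ⟨Z ∘ g, fun x ↦ hZ (g x), hc, htr, σ, hσ, fun x ↦ ?_, hlam⟩
  have rest : (∑ x' with g x' = g x, γ x' - γ x).PosSemidef := by
    rw [← Finset.sum_erase_eq_sub (by simp)]
    exact fiber_posSemidef _
  convert! (hσZ (g x)).add (conj_posSemidef rest (hZ (g x)).1) using 1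
  rw [Matrix.mul_sub, Matrix.sub_mul]
  exact (sub_add_sub_cancel _ _ _).symm

theorem filterable_mapClassical_of_comp [Fintype Y] [Fintype W] [DecidableEq W] [Fintype E]
    {ρ : Matrix (X × E) (X × E) ℂ} (hρ : ρ.PosSemidef) (f : X → Y) (g : Y → W)
    {c lam : ℝ} (h : Filterable (mapClassical (g ∘ f) ρ) c lam) :
    Filterable (mapClassical f ρ) c lam := by
  rw [← mapClassical_mapClassical] at h
  rw [mapClassical_eq_cqOperator f] at h ⊢
  exact filterable_of_mapClassical
    (fun y ↦ posSemidef_sum _ fun x _ ↦ diagBlock_posSemidef hρ x) g h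

end MapClassical

section Marginals

variable {X₀ X₁ E₀ E₁ : Type*} [Fintype X₀] [Fintype X₁]

theorem IsCQState.eq_cqOperator_diagBlock {X E : Type*} [Fintype X] [DecidableEq X] [Fintype E]
    {ρ : Matrix (X × E) (X × E) ℂ} (hρ : IsCQState ρ) : ρ = cqOperator (diagBlock ρ) := by
  obtain ⟨P, ρE, -, -, -, rfl⟩ := hρ
  simp only [← kronecker_smul, ← cqOperator_eq_sum, diagBlock_cqOperator]

theorem IsCQState.isState {X E : Type*} [Fintype X] [DecidableEq X] [Fintype E]
    {ρ : Matrix (X × E) (X × E) ℂ} (hρ : IsCQState ρ) : IsState ρ := by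
  obtain ⟨P, ρE, hP, hsum, hρE, rfl⟩ := hρ
  constructor
  · simp only [← kronecker_smul, ← cqOperator_eq_sum]
    exact cqOperator_posSemidef fun x ↦ posSemidef_real_smul (hρE x).1 (hP x)
  · simp only [trace_sum, trace_smul, trace_kronecker, trace_single_eq_same, (hρE _).2, mul_one,
      smul_eq_mul]
    exact_mod_cast hsum

theorem IsState.nonempty {A : Type*} [Fintype A] {ρ : Matrix A A ℂ} (hρ : IsState ρ) :
    Nonempty A := by
  by_contra! h
  simpa using hρ.2

theorem isState_partialTrace {A B : Type*} [Fintype A] [Fintype B] {ρ : Matrix (A × B) (A × B) ℂ}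
    (hρ : IsState ρ) : IsState (partialTrace ρ) :=
  ⟨partialTrace_posSemidef hρ.1, (trace_partialTrace ρ).trans hρ.2⟩

theorem adjoinSystem_cqOperator {X E R F : Type*} [DecidableEq X] (k : F ≃ E × R)
    (β : X → Matrix E E ℂ) (τ : Matrix R R ℂ) :
    adjoinSystem k (cqOperator β) τ = cqOperator fun x ↦ (β x ⊗ₖ τ).submatrix k k := by
  ext p p'
  exact ite_mul _ _ _ _ |>.trans (by rw [zero_mul]; rfl)

theorem mapClassical_fst_indepState [DecidableEq X₀] (ρ₀ : Matrix (X₀ × E₀) (X₀ × E₀) ℂ)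
    (ρ₁ : Matrix (X₁ × E₁) (X₁ × E₁) ℂ) :
    mapClassical Prod.fst (indepState ρ₀ ρ₁) =
      adjoinSystem (Equiv.refl _) (cqOperator (diagBlock ρ₀)) (partialTrace ρ₁) := by
  rw [mapClassical_eq_cqOperator, adjoinSystem_cqOperator]
  congr 1
  ext x e e'
  simp only [partialTrace_apply, Finset.sum_filter, Fintype.sum_prod_type]
  rw [Fintype.sum_eq_single x fun y hy ↦ by simp [hy]]
  simp only [↓reduceIte, Matrix.sum_apply, Equiv.coe_refl, submatrix_apply, id_eq,
    kroneckerMap_apply, Finset.mul_sum]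
  rfl

theorem mapClassical_snd_indepState [DecidableEq X₁] (ρ₀ : Matrix (X₀ × E₀) (X₀ × E₀) ℂ)
    (ρ₁ : Matrix (X₁ × E₁) (X₁ × E₁) ℂ) :
    mapClassical Prod.snd (indepState ρ₀ ρ₁) =
      adjoinSystem (Equiv.prodComm _ _) (cqOperator (diagBlock ρ₁)) (partialTrace ρ₀) := by
  rw [mapClassical_eq_cqOperator, adjoinSystem_cqOperator]
  congr 1
  ext x e e'
  simp only [partialTrace_apply, Finset.sum_filter, Fintype.sum_prod_type_right]
  rw [Fintype.sum_eq_single x fun y hy ↦ by simp [hy]]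
  simp only [↓reduceIte, Matrix.sum_apply, Equiv.coe_prodComm, submatrix_apply, kroneckerMap_apply,
    Prod.fst_swap, Prod.snd_swap, Finset.mul_sum, mul_comm]
  rfl

variable [Fintype E₀] [Fintype E₁] {ρ₀ : Matrix (X₀ × E₀) (X₀ × E₀) ℂ}
  {ρ₁ : Matrix (X₁ × E₁) (X₁ × E₁) ℂ} {c lam : ℝ}

theorem filterable_mapClassical_fst_indepState [DecidableEq X₀]
    (hρ₀ : IsCQState ρ₀) (hρ₁ : IsState ρ₁) (h : Filterable ρ₀ c lam) :
    Filterable (mapClassical Prod.fst (indepState ρ₀ ρ₁)) c lam := by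
  rw [mapClassical_fst_indepState, ← hρ₀.eq_cqOperator_diagBlock]
  exact filterable_adjoinSystem _ hρ₀.isState.1 h (isState_partialTrace hρ₁)

theorem filterable_mapClassical_snd_indepState [DecidableEq X₁]
    (hρ₀ : IsState ρ₀) (hρ₁ : IsCQState ρ₁) (h : Filterable ρ₁ c lam) :
    Filterable (mapClassical Prod.snd (indepState ρ₀ ρ₁)) c lam := by
  rw [mapClassical_snd_indepState, ← hρ₁.eq_cqOperator_diagBlock]
  exact filterable_adjoinSystem _ hρ₁.isState.1 h (isState_partialTrace hρ₀)

variable [DecidableEq X₀] [DecidableEq X₁]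
  {S : Type*} [Fintype S] [DecidableEq S]
  {ρ : Matrix (((X₀ × X₁) × (S × S)) × (E₀ × E₁)) (((X₀ × X₁) × (S × S)) × (E₀ × E₁)) ℂ}

theorem filterable_selectRegisters_false (hρ : ρ.PosSemidef)
    (hmarg : mapClassical Prod.fst ρ = indepState ρ₀ ρ₁) (hρ₀ : IsState ρ₀)
    (hρ₁ : IsCQState ρ₁) (h : Filterable ρ₁ c lam) :
    Filterable (mapClassical (selectRegisters false) ρ) c lam := by
  obtain ⟨x₁, -⟩ := hρ₁.isState.nonempty
  apply filterable_mapClassical_of_comp hρ (selectRegisters false)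
    (Sum.elim (fun _ ↦ x₁) id ∘ Prod.fst)
  change Filterable (mapClassical (Prod.snd ∘ Prod.fst) ρ) c lam
  rw [← mapClassical_mapClassical, hmarg]
  exact filterable_mapClassical_snd_indepState hρ₀ hρ₁ h

theorem filterable_selectRegisters_true (hρ : ρ.PosSemidef)
    (hmarg : mapClassical Prod.fst ρ = indepState ρ₀ ρ₁) (hρ₀ : IsCQState ρ₀)
    (hρ₁ : IsState ρ₁) (h : Filterable ρ₀ c lam) :
    Filterable (mapClassical (selectRegisters true) ρ) c lam := by
  obtain ⟨x₀, -⟩ := hρ₀.isState.nonempty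
  apply filterable_mapClassical_of_comp hρ (selectRegisters true)
    (Sum.elim id (fun _ ↦ x₀) ∘ Prod.fst)
  change Filterable (mapClassical (Prod.fst ∘ Prod.fst) ρ) c lam
  rw [← mapClassical_mapClassical, hmarg]
  exact filterable_mapClassical_fst_indepState hρ₀ hρ₁ h

end Marginals

section SmoothMinEntropy

variable {A B : Type*} [DecidableEq A] [Fintype B]

theorem minEntropyValue_nonneg (τ : Matrix (A × B) (A × B) ℂ) : 0 ≤ minEntropyValue τ := by
  refine Real.sInf_nonneg ?_
  rintro _ ⟨σ, hσ, -, rfl⟩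
  exact re_trace_nonneg hσ

theorem minEntropyValue_le {τ : Matrix (A × B) (A × B) ℂ} {lam : ℝ}
    (h : HasGuessingBound τ lam) : minEntropyValue τ ≤ lam := by
  obtain ⟨σ, hσ, hστ, hlam⟩ := h
  refine le_trans (csInf_le ⟨0, ?_⟩ ⟨σ, hσ, hστ, rfl⟩) hlam
  rintro _ ⟨σ', hσ', -, rfl⟩
  exact re_trace_nonneg hσ'

theorem le_minEntropy {τ : Matrix (A × B) (A × B) ℂ} {γ : ℝ}
    (h : HasGuessingBound τ (2 ^ (-γ))) : (γ : EReal) ≤ minEntropy τ := by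
  rw [minEntropy]
  split_ifs with h0
  · exact le_top
  · have hpos := (minEntropyValue_nonneg τ).lt_of_ne' h0
    rw [EReal.coe_le_coe_iff, le_neg, Real.logb_le_iff_le_rpow one_lt_two hpos]
    exact minEntropyValue_le h

theorem exists_hasGuessingBound [Finite A] {τ : Matrix (A × B) (A × B) ℂ} (hτ : τ.PosSemidef) :
    ∃ lam, HasGuessingBound τ lam := by
  classical
  cases nonempty_fintype A
  obtain ⟨κ, hκ⟩ := (isCompact_posSemidef_re_trace_le (Fintype.card B : ℝ)).bddAbove_image
    (continuous_expectation τ).continuousOn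
  refine ⟨max κ 1, hasGuessingBound_of_forall_dual hτ.1 (lt_max_of_lt_right one_pos)
    fun M hM hMB ↦ le_max_of_le_left (hκ ⟨M, ⟨hM, ?_⟩, rfl⟩)⟩
  have h := re_trace_nonneg hMB
  rw [trace_sub, trace_one, trace_partialTrace, Complex.sub_re, Complex.natCast_re] at h
  exact sub_nonneg.1 h

theorem hasGuessingBound_of_lt_minEntropy [Finite A] {τ : Matrix (A × B) (A × B) ℂ}
    (hτ : τ.PosSemidef) {γ : ℝ} (h : (γ : EReal) < minEntropy τ) :
    HasGuessingBound τ (2 ^ (-γ)) := by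
  have hlt : minEntropyValue τ < 2 ^ (-γ) := by
    rw [minEntropy] at h
    split_ifs at h with h0
    · rw [h0]
      positivity
    · have hpos := (minEntropyValue_nonneg τ).lt_of_ne' h0
      rwa [EReal.coe_lt_coe_iff, lt_neg, Real.logb_lt_iff_lt_rpow one_lt_two hpos] at h
  obtain ⟨lam, σ₁, hσ₁, hτσ₁, -⟩ := exists_hasGuessingBound hτ
  obtain ⟨_, ⟨σ, hσ, hτσ, rfl⟩, hσlt⟩ :=
    exists_lt_of_csInf_lt (by exact ⟨_, σ₁, hσ₁, hτσ₁, rfl⟩) hlt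
  exact ⟨σ, hσ, hτσ, hσlt.le⟩

theorem cDist_le_iff {n : Type*} [Fintype n] [DecidableEq n] {ε : ℝ} (hε : 0 ≤ ε)
    (ρ τ : Matrix n n ℂ) : cDist ρ τ ≤ ε ↔ 1 - ε ^ 2 ≤ fidelity ρ τ ^ 2 := by
  rw [cDist, Real.sqrt_le_left hε, sub_le_comm]

variable [Fintype A] [DecidableEq B]

theorem le_smoothMinEntropy {ρ : Matrix (A × B) (A × B) ℂ} (hρ : ρ.PosSemidef) {ε γ : ℝ}
    (hε : 0 ≤ ε) (h : Filterable ρ (1 - ε ^ 2) (2 ^ (-γ))) :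
    (γ : EReal) ≤ smoothMinEntropy ε ρ := by
  obtain ⟨Z, hZ, hc, htr, hbound⟩ := h
  refine (le_minEntropy hbound).trans (le_iSup₂_of_le _ ⟨conj_posSemidef hρ hZ.1, ?_, ?_⟩ le_rfl)
  · rwa [cDist_le_iff hε, fidelity_conj hρ hZ]
  · rwa [← expectation_one, expectation_conj, Matrix.mul_one]

theorem exists_of_lt_smoothMinEntropy {ρ : Matrix (A × B) (A × B) ℂ} {ε γ : ℝ} (hε : 0 ≤ ε)
    (h : (γ : EReal) < smoothMinEntropy ε ρ) :
    ∃ τ : Matrix (A × B) (A × B) ℂ, τ.PosSemidef ∧ τ.trace.re ≤ 1 ∧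
      1 - ε ^ 2 ≤ fidelity ρ τ ^ 2 ∧ HasGuessingBound τ (2 ^ (-γ)) := by
  rw [smoothMinEntropy, lt_iSup_iff] at h
  obtain ⟨τ, h⟩ := h
  obtain ⟨⟨hτ, hdist, htr⟩, h⟩ := lt_iSup_iff.1 h
  exact ⟨τ, hτ, htr, (cDist_le_iff hε ρ τ).1 hdist, hasGuessingBound_of_lt_minEntropy hτ h⟩

theorem filterable_or_filterable_of_lt_smoothMinEntropy {A₀ A₁ B₀ B₁ : Type*}
    [Fintype A₀] [DecidableEq A₀] [Fintype A₁] [DecidableEq A₁]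
    [Fintype B₀] [DecidableEq B₀] [Fintype B₁] [DecidableEq B₁]
    {ρ₀ : Matrix (A₀ × B₀) (A₀ × B₀) ℂ} {ρ₁ : Matrix (A₁ × B₁) (A₁ × B₁) ℂ}
    (hρ₀ : IsState ρ₀) (hρ₁ : IsState ρ₁) {ε₀ ε₁ : ℝ} (hε₀ : 0 ≤ ε₀) (hε₁ : 0 ≤ ε₁)
    {δ₀ δ₁ γ₀ γ₁ : ℝ} (hγ₀ : γ₀ < δ₀) (hγ₁ : γ₁ < δ₁)
    (h : ((δ₀ + δ₁ : ℝ) : EReal) < smoothMinEntropy (ε₀ * ε₁) (indepState ρ₀ ρ₁)) :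
    Filterable ρ₀ (1 - ε₀ ^ 2) (2 ^ (-γ₀)) ∨ Filterable ρ₁ (1 - ε₁ ^ 2) (2 ^ (-γ₁)) := by
  have rpow_lt {γ δ : ℝ} (h : γ < δ) : (2 : ℝ) ^ (-δ) < 2 ^ (-γ) :=
    Real.rpow_lt_rpow_of_exponent_lt one_lt_two (neg_lt_neg h)
  have pos (δ : ℝ) : (0 : ℝ) < 2 ^ (-δ) := Real.rpow_pos_of_pos two_pos _
  obtain hfilter | ⟨M₀, q₀, hM₀, hq₀, hbal₀, hlt₀⟩ :=
    filterable_or_exists_isDualFeasible hρ₀.1 (pos δ₀) (rpow_lt hγ₀) (1 - ε₀ ^ 2)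
  · exact .inl hfilter
  obtain hfilter | ⟨M₁, q₁, hM₁, hq₁, hbal₁, hlt₁⟩ :=
    filterable_or_exists_isDualFeasible hρ₁.1 (pos δ₁) (rpow_lt hγ₁) (1 - ε₁ ^ 2)
  · exact .inr hfilter
  obtain ⟨τ, hτ, htr, hfid, hbound⟩ := exists_of_lt_smoothMinEntropy (mul_nonneg hε₀ hε₁) h
  rw [neg_add, Real.rpow_add two_pos] at hbound
  have upper := fidelity_sq_indepState_le hρ₀ hρ₁ hM₀ hM₁ (pos δ₀) (pos δ₁) hq₀ hq₁ hbal₀ hbal₁ hτ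
    htr hbound
  rw [mul_pow] at hfid
  nlinarith [sq_nonneg ε₀, sq_nonneg ε₁]

end SmoothMinEntropy

theorem mainTheorem10_general {X₀ X₁ E₀ E₁ S : Type*}
    [Fintype X₀] [DecidableEq X₀] [Fintype X₁] [DecidableEq X₁]
    [Fintype E₀] [DecidableEq E₀] [Fintype E₁] [DecidableEq E₁] [Fintype S] [DecidableEq S]
    {ε₀ ε₁ : ℝ} (hε₀ : 0 ≤ ε₀) (hε₁ : 0 ≤ ε₁) {α₀ α₁ : ℝ}
    {ρ₀ : Matrix (X₀ × E₀) (X₀ × E₀) ℂ} (hρ₀ : IsCQState ρ₀)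
    {ρ₁ : Matrix (X₁ × E₁) (X₁ × E₁) ℂ} (hρ₁ : IsCQState ρ₁)
    (hα : ((α₀ + α₁ : ℝ) : EReal) ≤ smoothMinEntropy (ε₀ * ε₁) (indepState ρ₀ ρ₁))
    {ρ : Matrix (((X₀ × X₁) × (S × S)) × (E₀ × E₁)) (((X₀ × X₁) × (S × S)) × (E₀ × E₁)) ℂ}
    (hρ : ρ.PosSemidef) (hmarg : mapClassical Prod.fst ρ = indepState ρ₀ ρ₁) :
    (α₁ : EReal) ≤ smoothMinEntropy ε₁ (mapClassical (selectRegisters false) ρ) ∨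
      (α₀ : EReal) ≤ smoothMinEntropy ε₀ (mapClassical (selectRegisters true) ρ) := by
  by_contra! hlt
  obtain ⟨γ₁, hγ₁, hγ₁α₁⟩ := EReal.lt_iff_exists_real_btwn.1 hlt.1
  obtain ⟨γ₀, hγ₀, hγ₀α₀⟩ := EReal.lt_iff_exists_real_btwn.1 hlt.2
  obtain ⟨δ₁, hγδ₁, hδα₁⟩ := exists_between (EReal.coe_lt_coe_iff.1 hγ₁α₁)
  obtain ⟨δ₀, hγδ₀, hδα₀⟩ := exists_between (EReal.coe_lt_coe_iff.1 hγ₀α₀)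
  have hδ : ((δ₀ + δ₁ : ℝ) : EReal) < smoothMinEntropy (ε₀ * ε₁) (indepState ρ₀ ρ₁) :=
    (EReal.coe_lt_coe (add_lt_add hδα₀ hδα₁)).trans_le hα
  rcases filterable_or_filterable_of_lt_smoothMinEntropy hρ₀.isState hρ₁.isState hε₀ hε₁ hγδ₀ hγδ₁
    hδ with h₀ | h₁
  · exact hγ₀.not_ge (le_smoothMinEntropy (mapClassical_posSemidef _ hρ) hε₀
      (filterable_selectRegisters_true hρ hmarg hρ₀ hρ₁.isState h₀))
  · exact hγ₁.not_ge (le_smoothMinEntropy (mapClassical_posSemidef _ hρ) hε₁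
      (filterable_selectRegisters_false hρ hmarg hρ₀.isState hρ₁ h₁))

theorem mainTheorem10 {X₀ X₁ E₀ E₁ : Type*}
    [Fintype X₀] [DecidableEq X₀] [Fintype X₁] [DecidableEq X₁]
    [Fintype E₀] [DecidableEq E₀] [Fintype E₁] [DecidableEq E₁]
    (ε : ℝ) (hε : 0 ≤ ε) (α : ℝ) (ℓ : ℕ)
    (ρ₀ : Matrix (X₀ × E₀) (X₀ × E₀) ℂ) (hρ₀ : IsCQState ρ₀)
    (ρ₁ : Matrix (X₁ × E₁) (X₁ × E₁) ℂ) (hρ₁ : IsCQState ρ₁)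
    (hα : (α : EReal) ≤ smoothMinEntropy (ε ^ 2) (indepState ρ₀ ρ₁))
    (ρ : Matrix (((X₀ × X₁) × (BitString ℓ × BitString ℓ)) × (E₀ × E₁))
      (((X₀ × X₁) × (BitString ℓ × BitString ℓ)) × (E₀ × E₁)) ℂ)
    (hρ : IsCQState ρ) (hmarg : mapClassical Prod.fst ρ = indepState ρ₀ ρ₁) :
    ∃ d : Bool, ((α / 2 : ℝ) : EReal) ≤
      smoothMinEntropy ε (mapClassical (selectRegisters d) ρ) := by
  rw [sq] at hα
  rw [Bool.exists_bool]
  exact mainTheorem10_general hε hε hρ₀ hρ₁ (by rwa [add_halves]) hρ.isState.1 hmarg
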